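/- Let $\mathcal G$ be a real Lie algebra of finite dimension $n\ge 6$, and let $\mathcal G^1=[\mathcal G,\mathcal G]$. Suppose that $\mathcal G$ is 1-step solvable (i.e. $\mathcal G^1$ is commutative and $\mathcal G^1\ne 0$), that $\dim \mathcal G^1\ge 3$, and that every non-trivial coadjoint orbit (i.e. one with more than one point) in $\mathcal G^*$ of the simply connected Lie group with Lie algebra $\mathcal G$ has dimension $n-2$. Then $n=6$ and $\dim\mathcal G^1=4$. Moreover, $\mathcal G$ is isomorphic to one of the following Lie algebras with basis $x_1,\dots,x_6$; the parameters are real numbers, $[x_1,x_2]=0$, $[x_i,x_j]=0$ for $3\le i,j\le 6$, and the remaining brackets are as listed. 1. $\mathfrak s_{6,211}$: $[x_1,x_3]=x_3$, $[x_1,x_4]=x_4$, $[x_1,x_5]=x_5+x_3$, $[x_1,x_6]=x_6+x_4$, $[x_2,x_3]=-x_4$, $[x_2,x_4]=x_3$, $[x_2,x_5]=-x_6$, $[x_2,x_6]=x_5$. 2. $\mathfrak s_{6,225}(\nu,\theta)$ with $\nu\ge 0$: $[x_1,x_3]=x_3$, $[x_1,x_4]=x_4$, $[x_1,x_5]=x_5+\nu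 x_3-\theta x_4$, $[x_1,x_6]=x_6+\theta x_3+\nu x_4$, $[x_2,x_3]=-x_4$, $[x_2,x_4]=x_3$, $[x_2,x_5]=-x_6+x_3$, $[x_2,x_6]=x_5$. 3. $\mathfrak s_{6,226}(\lambda,\mu,\zeta)$ with $\lambda\ne 0$, $\mu\ge 0$, $0<\zeta\le 1$, and $|\lambda|\le 1$ if $\zeta=1$: $[x_1,x_3]=\lambda x_3$, $[x_1,x_4]=\lambda x_4$, $[x_1,x_5]=x_5$, $[x_1,x_6]=x_6$, $[x_2,x_3]=\mu x_3-\zeta x_4$, $[x_2,x_4]=\zeta x_3+\mu x_4$, $[x_2,x_5]=-x_6$, $[x_2,x_6]=x_5$. 4. $\mathfrak s_{6,228}(\lambda,\mu,\eta,\zeta)$ with $\eta\neq 0$, $\lambda\zeta-\mu\eta>0$ and $\mu\ge 0$: $[x_1,x_3]=\lambda x_3-\eta x_4$, $[x_1,x_4]=\eta x_3+\lambda x_4$, $[x_1,x_5]=x_5$, $[x_1,x_6]=x_6$, $[x_2,x_3]=\mu x_3-\zeta x_4$, $[x_2,x_4]=\zeta x_3+\mu x_4$, $[x_2,x_5]=-x_6$,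 $[x_2,x_6]=x_5$. -/

import Mathlib

noncomputable section

namespace MDAlgebra

/-! ### The coadjoint action -/

section Coadjoint

variable {V : Type*} [AddCommGroup V] [Module ℝ V]

/-- The exponential `∑ fⁿ / n!` of an endomorphism `f` of a (finite-dimensional) real vector space.
The sum is taken in the canonical vector space topology of the space of endomorphisms. -/
def expEnd (f : Module.End ℝ V) : Module.End ℝ V :=
  letI : TopologicalSpace (Module.End ℝ V) := moduleTopology ℝ (Module.End ℝ V)
  ∑' n : ℕ, ((n.factorial : ℝ)⁻¹) • f ^ n

open scoped Matrix.Norms.Operator in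
lemma expEnd_eq_matrix [FiniteDimensional ℝ V] {ι : Type*} [Fintype ι] [DecidableEq ι]
    (b : Module.Basis ι ℝ V) (f : Module.End ℝ V) :
    expEnd f = (LinearMap.toMatrixAlgEquiv b).symm
      (NormedSpace.exp (LinearMap.toMatrixAlgEquiv b f)) := by
  let : TopologicalSpace (Module.End ℝ V) := moduleTopology ℝ (Module.End ℝ V)
  have : IsModuleTopology ℝ (Module.End ℝ V) := ⟨rfl⟩
  have : ContinuousAdd (Module.End ℝ V) := IsModuleTopology.toContinuousAdd ℝ _
  have : ContinuousSMul ℝ (Module.End ℝ V) := IsModuleTopology.toContinuousSMul ℝ _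
  have : IsTopologicalAddGroup (Module.End ℝ V) :=
    IsModuleTopology.topologicalAddGroup ℝ _
  set e := LinearMap.toMatrixAlgEquiv b with he
  have hc : Continuous e := IsModuleTopology.continuous_of_linearMap e.toLinearMap
  have hc' : Continuous e.symm :=
    LinearMap.continuous_of_finiteDimensional e.symm.toLinearMap
  have : T2Space (Module.End ℝ V) := T2Space.of_injective_continuous e.injective hc
  have hs : HasSum (fun n : ℕ => ((n.factorial : ℝ)⁻¹) • (e f) ^ n) (NormedSpace.exp (e f)) :=
    NormedSpace.exp_series_hasSum_exp' (𝕂 := ℝ) (e f)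
  have h2 := hs.map e.symm.toLinearMap.toAddMonoidHom hc'
  have h3 : HasSum (fun n : ℕ => ((n.factorial : ℝ)⁻¹) • f ^ n)
      (e.symm (NormedSpace.exp (e f))) := by
    have h4 : (⇑e.symm.toLinearMap.toAddMonoidHom ∘
        fun n : ℕ => ((n.factorial : ℝ)⁻¹) • (e f) ^ n) =
        fun n : ℕ => ((n.factorial : ℝ)⁻¹) • f ^ n := by
      funext n
      simp
    rw [h4] at h2
    exact h2
  exact h3.tsum_eq

open scoped Matrix.Norms.Operator in
lemma comp_expEnd_smul_eq_iff [FiniteDimensional ℝ V] (F : Module.Dual ℝ V)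
    (f : Module.End ℝ V) :
    (∀ t : ℝ, F ∘ₗ expEnd (t • f) = F) ↔ F ∘ₗ f = 0 := by
  set b := Module.finBasis ℝ V
  set e := LinearMap.toMatrixAlgEquiv b
  have key : ∀ (y : V) (t : ℝ), HasDerivAt (fun t : ℝ => F (expEnd (t • f) y))
      (F (f (expEnd (t • f) y))) t := by
    intro y t
    have h := hasDerivAt_exp_smul_const' (𝕂 := ℝ) (e f) t
    let L : Matrix _ _ ℝ →ₗ[ℝ] ℝ :=
      F ∘ₗ (LinearMap.applyₗ y) ∘ₗ e.symm.toLinearMap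
    have h2 := L.toContinuousLinearMap.hasFDerivAt.comp_hasDerivAt t h
    have h3 : (⇑(LinearMap.toContinuousLinearMap L) ∘ fun u : ℝ => NormedSpace.exp (u • e f)) =
        fun t : ℝ => F (expEnd (t • f) y) := by
      funext s
      simp [L, expEnd_eq_matrix b, e]
    have h4 : (LinearMap.toContinuousLinearMap L) (e f * NormedSpace.exp (t • e f)) =
        F (f (expEnd (t • f) y)) := by
      simp [L, expEnd_eq_matrix b, e]
    exact (h2.congr_deriv h4).congr_of_eventuallyEq
      (Filter.Eventually.of_forall fun s => (congrFun h3 s).symm)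
  constructor
  · intro h
    ext y
    have h0 := key y 0
    have hF : ∀ t z, F (expEnd (t • f) z) = F z := fun t z => LinearMap.congr_fun (h t) z
    have h1 : expEnd ((0 : ℝ) • f) = 1 := by
      rw [expEnd_eq_matrix b]; simp
    simp only [hF] at h0
    rw [h1] at h0
    have := h0.unique (hasDerivAt_const (0 : ℝ) (F y))
    simpa using this
  · intro h t
    have hF : ∀ z, F (f z) = 0 := fun z => LinearMap.congr_fun h z
    ext y
    have hd : ∀ s, HasDerivAt (fun t : ℝ => F (expEnd (t • f) y)) 0 s := by
      intro s
      have := key y s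
      rwa [hF] at this
    have hcst := is_const_of_deriv_eq_zero (fun s => (hd s).differentiableAt)
      (fun s => (hd s).deriv) t 0
    have h1 : expEnd ((0 : ℝ) • f) = 1 := by
      rw [expEnd_eq_matrix b]; simp
    simp only [h1] at hcst
    simpa using hcst

end Coadjoint

section Orbits

variable (𝒢 : Type*) [LieRing 𝒢] [LieAlgebra ℝ 𝒢]

/-- The image `Ad(G)` of the adjoint representation of the simply connected Lie group `G` with Lie
algebra `𝒢`. As `G` is connected, it is generated by the elements `exp x`, `x ∈ 𝒢`, and
`Ad (exp x) = exp (ad x)`; so `Ad(G)` is the subgroup of `GL(𝒢)` generated by the `exp (ad x)`. -/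
def adjointGroup : Subgroup (LinearMap.GeneralLinearGroup ℝ 𝒢) :=
  Subgroup.closure {g | ∃ x : 𝒢, (g : Module.End ℝ 𝒢) = expEnd (LieAlgebra.ad ℝ 𝒢 x)}

variable {𝒢}

/-- The coadjoint orbit `Ω_F = {F ∘ Ad(g⁻¹) : g ∈ G}` of `F ∈ 𝒢*`. -/
def coadjointOrbit (F : Module.Dual ℝ 𝒢) : Set (Module.Dual ℝ 𝒢) :=
  {F' | ∃ g ∈ adjointGroup 𝒢, F' = F ∘ₗ ((g⁻¹ : LinearMap.GeneralLinearGroup ℝ 𝒢) :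
    Module.End ℝ 𝒢)}

/-- The Lie algebra `𝒢_F = {x ∈ 𝒢 : exp (t x) ∈ G_F for all t ∈ ℝ}` of the stabilizer `G_F` of
`F ∈ 𝒢*` under the coadjoint action; here `exp (t x)` maps `F` to `F ∘ exp (-t ad x)`. -/
def stabilizerAlgebra [FiniteDimensional ℝ 𝒢] (F : Module.Dual ℝ 𝒢) : Submodule ℝ 𝒢 where
  carrier := {x | ∀ t : ℝ, F ∘ₗ expEnd (t • -LieAlgebra.ad ℝ 𝒢 x) = F}
  add_mem' {x y} hx hy := by
    simp only [Set.mem_ofPred_eq, comp_expEnd_smul_eq_iff] at *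
    rw [map_add, neg_add, LinearMap.comp_add, hx, hy, add_zero]
  zero_mem' := by
    simp only [Set.mem_ofPred_eq, comp_expEnd_smul_eq_iff, map_zero, neg_zero,
      LinearMap.comp_zero]
  smul_mem' c x hx := by
    simp only [Set.mem_ofPred_eq, comp_expEnd_smul_eq_iff] at *
    rw [map_smul, ← smul_neg, LinearMap.comp_smul, hx, smul_zero]

/-- The dimension of the coadjoint orbit `Ω_F`, as the homogeneous manifold `G / G_F`:
it is `dim G - dim G_F`. -/
def coadjointOrbitDim [FiniteDimensional ℝ 𝒢] (F : Module.Dual ℝ 𝒢) : ℕ :=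
  Module.finrank ℝ 𝒢 - Module.finrank ℝ (stabilizerAlgebra F)

variable (𝒢)

/-- All non-trivial coadjoint orbits (those with more than one point) of `𝒢` have dimension `k`. -/
def NontrivialCoadjointOrbitsHaveDim [FiniteDimensional ℝ 𝒢] (k : ℕ) : Prop :=
  ∀ F : Module.Dual ℝ 𝒢, (coadjointOrbit F).Nontrivial → coadjointOrbitDim F = k

/-- `𝒢` is `i`-step solvable: its `i`-th derived algebra is commutative and non-zero. -/
def IsStepSolvable (i : ℕ) : Prop :=
  IsLieAbelian (LieAlgebra.derivedSeries ℝ 𝒢 i) ∧ LieAlgebra.derivedSeries ℝ 𝒢 i ≠ ⊥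

end Orbits

/-! ### The Lie algebras of the classification -/

/-- A pair of commuting real `4 × 4` matrices. -/
structure CommutingPair where
  /-- the matrix of `ad x₁` on `⟨x₃, x₄, x₅, x₆⟩` -/
  A : Matrix (Fin 4) (Fin 4) ℝ
  /-- the matrix of `ad x₂` on `⟨x₃, x₄, x₅, x₆⟩` -/
  B : Matrix (Fin 4) (Fin 4) ℝ
  comm : A * B = B * A

/-- The semidirect sum `ℝ² ⋉ ℝ⁴` given by a pair of commuting matrices `A, B`. With `x₁, x₂` the
standard basis of `ℝ²` and `x₃, x₄, x₅, x₆` that of `ℝ⁴`, the subspaces `ℝ²` and `ℝ⁴` are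
commutative and `ad x₁`, `ad x₂` act on `ℝ⁴` (column vectors) through `A`, `B`. -/
@[ext] structure SemidirectR2R4 (P : CommutingPair) where
  /-- the coordinates with respect to `x₁, x₂` -/
  u : Fin 2 → ℝ
  /-- the coordinates with respect to `x₃, x₄, x₅, x₆` -/
  v : Fin 4 → ℝ

namespace SemidirectR2R4

variable {P : CommutingPair}

/-- As a vector space, `ℝ² ⋉ ℝ⁴` is `ℝ² × ℝ⁴`. -/
def toProd : SemidirectR2R4 P ≃ (Fin 2 → ℝ) × (Fin 4 → ℝ) where
  toFun x := (x.u, x.v)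
  invFun p := ⟨p.1, p.2⟩
  left_inv _ := rfl
  right_inv _ := rfl

instance : AddCommGroup (SemidirectR2R4 P) := toProd.addCommGroup

instance : Module ℝ (SemidirectR2R4 P) := toProd.module ℝ

/-- The action `u₁ A + u₂ B` of `u₁ x₁ + u₂ x₂` on `ℝ⁴`. -/
def act (P : CommutingPair) (u : Fin 2 → ℝ) : Matrix (Fin 4) (Fin 4) ℝ :=
  u 0 • P.A + u 1 • P.B

instance : Bracket (SemidirectR2R4 P) (SemidirectR2R4 P) where
  bracket x y := ⟨0, (act P x.u).mulVec y.v - (act P y.u).mulVec x.v⟩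

lemma add_def (x y : SemidirectR2R4 P) : x + y = ⟨x.u + y.u, x.v + y.v⟩ := rfl
lemma zero_def : (0 : SemidirectR2R4 P) = ⟨0, 0⟩ := rfl
lemma smul_def (c : ℝ) (x : SemidirectR2R4 P) : c • x = ⟨c • x.u, c • x.v⟩ := rfl
lemma lie_def (x y : SemidirectR2R4 P) :
    ⁅x, y⁆ = ⟨0, (act P x.u).mulVec y.v - (act P y.u).mulVec x.v⟩ := rfl

lemma act_add (u w : Fin 2 → ℝ) : act P (u + w) = act P u + act P w := by
  simp only [act, Pi.add_apply, add_smul]; abel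

lemma act_smul (c : ℝ) (u : Fin 2 → ℝ) : act P (c • u) = c • act P u := by
  simp only [act, Pi.smul_apply, smul_eq_mul, smul_add, smul_smul]

lemma act_zero : act P 0 = 0 := by simp [act]

lemma act_comm (u w : Fin 2 → ℝ) : act P u * act P w = act P w * act P u := by
  simp only [act, add_mul, mul_add, smul_mul_assoc, mul_smul_comm, P.comm]
  module

instance : LieRing (SemidirectR2R4 P) where
  add_lie x y z := by
    ext i <;> simp [lie_def, add_def, act_add, Matrix.add_mulVec, Matrix.mulVec_add]; ring
  lie_add x y z := by
    ext i <;> simp [lie_def, add_def, act_add, Matrix.add_mulVec, Matrix.mulVec_add]; ring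
  lie_self x := by simp [lie_def, zero_def]
  leibniz_lie x y z := by
    ext i
    · simp [lie_def, add_def]
    · simp only [lie_def, add_def, act_zero, Matrix.mulVec_sub, Matrix.mulVec_mulVec,
        Matrix.zero_mulVec, act_comm y.u x.u, act_comm z.u x.u, act_comm z.u y.u,
        Pi.add_apply, Pi.sub_apply, Pi.zero_apply]
      ring

instance : LieAlgebra ℝ (SemidirectR2R4 P) where
  lie_smul c x y := by
    ext i <;> simp [lie_def, smul_def, act_smul, Matrix.smul_mulVec, Matrix.mulVec_smul]; ring

end SemidirectR2R4

/-- The Lie algebra `𝔰_{6,211}`: `[x₁,x₃] = x₃`, `[x₁,x₄] = x₄`, `[x₁,x₅] = x₅ + x₃`,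
`[x₁,x₆] = x₆ + x₄`, `[x₂,x₃] = -x₄`, `[x₂,x₄] = x₃`, `[x₂,x₅] = -x₆`, `[x₂,x₆] = x₅`. -/
abbrev S211 : Type :=
  SemidirectR2R4
    { A := !![1, 0, 1, 0;
              0, 1, 0, 1;
              0, 0, 1, 0;
              0, 0, 0, 1]
      B := !![0, 1, 0, 0;
              -1, 0, 0, 0;
              0, 0, 0, 1;
              0, 0, -1, 0]
      comm := by simp }

/-- The Lie algebra `𝔰_{6,225}(ν,θ)`: `[x₁,x₃] = x₃`, `[x₁,x₄] = x₄`,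
`[x₁,x₅] = x₅ + ν x₃ - θ x₄`, `[x₁,x₆] = x₆ + θ x₃ + ν x₄`, `[x₂,x₃] = -x₄`, `[x₂,x₄] = x₃`,
`[x₂,x₅] = -x₆ + x₃`, `[x₂,x₆] = x₅`. -/
abbrev S225 (ν θ : ℝ) : Type :=
  SemidirectR2R4
    { A := !![1, 0, ν, θ;
              0, 1, -θ, ν;
              0, 0, 1, 0;
              0, 0, 0, 1]
      B := !![0, 1, 1, 0;
              -1, 0, 0, 0;
              0, 0, 0, 1;
              0, 0, -1, 0]
      comm := by simp [add_comm] }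

/-- The Lie algebra `𝔰_{6,228}(λ,μ,η,ζ)` (the first parameter is called `l` here):
`[x₁,x₃] = λ x₃ - η x₄`, `[x₁,x₄] = η x₃ + λ x₄`, `[x₁,x₅] = x₅`, `[x₁,x₆] = x₆`,
`[x₂,x₃] = μ x₃ - ζ x₄`, `[x₂,x₄] = ζ x₃ + μ x₄`, `[x₂,x₅] = -x₆`, `[x₂,x₆] = x₅`. -/
abbrev S228 (l μ η ζ : ℝ) : Type :=
  SemidirectR2R4
    { A := !![l, η, 0, 0;
              -η, l, 0, 0;
              0, 0, 1, 0;
              0, 0, 0, 1]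
      B := !![μ, ζ, 0, 0;
              -ζ, μ, 0, 0;
              0, 0, 0, 1;
              0, 0, -1, 0]
      comm := by
        ext i j
        fin_cases i <;> fin_cases j <;> simp [Matrix.mul_apply, Fin.sum_univ_four] <;> ring }

/-- The Lie algebra `𝔰_{6,226}(λ,μ,ζ)` (the first parameter is called `l` here):
`[x₁,x₃] = λ x₃`, `[x₁,x₄] = λ x₄`, `[x₁,x₅] = x₅`, `[x₁,x₆] = x₆`,
`[x₂,x₃] = μ x₃ - ζ x₄`, `[x₂,x₄] = ζ x₃ + μ x₄`, `[x₂,x₅] = -x₆`, `[x₂,x₆] = x₅`. -/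
abbrev S226 (l μ ζ : ℝ) : Type :=
  SemidirectR2R4
    { A := !![l, 0, 0, 0;
              0, l, 0, 0;
              0, 0, 1, 0;
              0, 0, 0, 1]
      B := !![μ, ζ, 0, 0;
              -ζ, μ, 0, 0;
              0, 0, 0, 1;
              0, 0, -1, 0]
      comm := by
        ext i j
        fin_cases i <;> fin_cases j <;> simp [Matrix.mul_apply, Fin.sum_univ_four] <;> ring }

end MDAlgebra

end

/-! Write D for the derived algebra. A functional F on the Lie algebra that is nonzero on D has a
non-trivial orbit, so the radical of the form F⁅x, y⁆, which is `stabilizerAlgebra F`, has dimension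
2. The Lie algebra acts on the dual of D by commuting operators, and no nonzero functional on D is
killed by all of them: otherwise such a radical would contain D. Hence some x₀ acts injectively
(`exists_injective_of_commute`), and its centralizer L is an abelian complement of D
(`isCompl_ker_ad`).

The form F⁅x, y⁆ only pairs L with D. If this pairing has rank r, the radical has dimension at least
n - 2r, so n ≤ 2 + 2r. A complex joint weight yields an F with r ≤ 2, whence n = 6; if dim D were 3,
a real joint eigenvector would yield r ≤ 1. So dim D = 4, dim L = 2, and every nonzero element of L
acts injectively on D (`structure_of_finrank_stabilizerAlgebra`).

It remains to classify commuting pencils with this injectivity. Such a pencil acts by complex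
multiplications on an invariant plane and on the quotient (`IsRegularPencil.exists_block_form`), and
a change of basis of the pencil makes the quotient act by 1 and -I. Shears remove the off-diagonal
part unless the two planes carry isomorphic actions (`hasNormalForm_block`). The split pencils give
𝔰_{6,226} and 𝔰_{6,228}, the non-split ones 𝔰_{6,211} and 𝔰_{6,225}. -/

namespace MDAlgebra

/-! ### Joint weights of commuting families. -/

section CommutingFamilies

/-- A commuting family of endomorphisms has a joint eigenvector in every invariant subspace of
dimension in `P`, if `P` is a class of nonzero dimensions that contains a summand of each of its
sums and in which every single endomorphism has an eigenvalue. -/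
theorem exists_joint_eigenvector_of_finrank {K E ι : Type*} [Field K] [AddCommGroup E] [Module K E]
    [FiniteDimensional K E] (P : ℕ → Prop) (P_zero : ¬ P 0)
    (P_add : ∀ a b, P (a + b) → P a ∨ P b)
    (P_eig : ∀ (p : Submodule K E), P (Module.finrank K p) → ∀ f : Module.End K p,
      ∃ a, f.HasEigenvalue a)
    (T : ι → Module.End K E) (hT : ∀ i j, Commute (T i) (T j)) (p : Submodule K E)
    (hp : P (Module.finrank K p)) (hinv : ∀ i, ∀ v ∈ p, T i v ∈ p) :
    ∃ v ∈ p, v ≠ 0 ∧ ∃ χ : ι → K, ∀ i, T i v = χ i • v := by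
  induction hd : Module.finrank K p using Nat.strong_induction_on generalizing p with
  | _ d ih =>
  subst hd
  by_cases hs : ∀ i, ∃ c : K, ∀ v ∈ p, T i v = c • v
  · choose χ hχ using hs
    have hne : p ≠ ⊥ := by
      rintro rfl
      exact P_zero (by simpa using hp)
    obtain ⟨v, hv, hv0⟩ := Submodule.exists_mem_ne_zero_of_ne_bot hne
    exact ⟨v, hv, hv0, χ, fun i => hχ i v hv⟩
  push Not at hs
  obtain ⟨i, hi⟩ := hs
  set f : Module.End K p := (T i).restrict (hinv i) with hf
  obtain ⟨a, ha⟩ := P_eig p hp f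
  -- `T i` is not scalar on `p`, so the kernel and the range of `S` are both nonzero and proper.
  -- They are invariant under the whole family and their dimensions add up to that of `p`, so
  -- `P_add` lets the induction continue in one of them.
  set S : Module.End K p := f - algebraMap K _ a with hS
  have hSv : ∀ v : p, ((S v : p) : E) = T i v - a • (v : E) := fun v => by
    simp [hS, hf, Module.algebraMap_end_apply]
  have hadd := S.finrank_range_add_finrank_ker
  have hker : Module.finrank K (LinearMap.ker S) ≠ 0 := by
    intro h0
    obtain ⟨v, hv⟩ := ha.exists_hasEigenvector
    have hvk : v ∈ LinearMap.ker S := by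
      simp [hS, Module.algebraMap_end_apply, hv.apply_eq_smul]
    rw [Submodule.finrank_eq_zero] at h0
    rw [h0] at hvk
    exact hv.2 (by simpa using hvk)
  have hrange : Module.finrank K (LinearMap.range S) ≠ 0 := by
    intro h0
    rw [Submodule.finrank_eq_zero, LinearMap.range_eq_bot] at h0
    obtain ⟨v, hv, hne⟩ := hi a
    apply hne
    have := hSv ⟨v, hv⟩
    rw [h0] at this
    exact sub_eq_zero.mp (by simpa using this.symm)
  have hcomm : ∀ j, ∀ v : p, T j (S v : p) = ((S ⟨T j v, hinv j v v.2⟩ : p) : E) := by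
    intro j v
    rw [hSv, hSv, map_sub, map_smul]
    congr 1
    exact LinearMap.congr_fun (hT j i).eq v
  have hmap : ∀ q : Submodule K p,
      Module.finrank K (q.map p.subtype) = Module.finrank K q := fun q =>
    Submodule.finrank_map_subtype_eq p q
  rw [← hadd] at hp
  rcases P_add _ _ hp with h | h
  · obtain ⟨v, hv, h'⟩ := ih _ (by omega) ((LinearMap.range S).map p.subtype)
      (by rwa [hmap]) (by
        rintro j _ ⟨_, ⟨v, rfl⟩, rfl⟩
        exact ⟨_, ⟨⟨T j v, hinv j v v.2⟩, rfl⟩, (hcomm j v).symm⟩) (hmap _)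
    obtain ⟨w, -, rfl⟩ := hv
    exact ⟨_, w.2, h'⟩
  · obtain ⟨v, hv, h'⟩ := ih _ (by omega) ((LinearMap.ker S).map p.subtype)
      (by rwa [hmap]) (by
        rintro j _ ⟨v, hv, rfl⟩
        refine ⟨⟨T j v, hinv j v v.2⟩, ?_, rfl⟩
        have hv : S v = 0 := hv
        have := hcomm j v
        rw [hv] at this
        exact Subtype.ext (by simpa using this.symm)) (hmap _)
    obtain ⟨w, -, rfl⟩ := hv
    exact ⟨_, w.2, h'⟩

theorem exists_joint_eigenvector_complex {E ι : Type*} [AddCommGroup E] [Module ℂ E]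
    [FiniteDimensional ℂ E] [Nontrivial E]
    (T : ι → Module.End ℂ E) (hT : ∀ i j, Commute (T i) (T j)) :
    ∃ v : E, v ≠ 0 ∧ ∃ χ : ι → ℂ, ∀ i, T i v = χ i • v := by
  obtain ⟨v, -, h⟩ := exists_joint_eigenvector_of_finrank (fun d => d ≠ 0) (by simp)
    (fun a b h => by omega)
    (fun p hp f => by
      have : Nontrivial p := Module.finrank_pos_iff.mp (Nat.pos_of_ne_zero hp)
      exact Module.End.exists_eigenvalue f) T hT ⊤
    (by simpa using (Module.finrank_pos (R := ℂ) (M := E)).ne') (by simp)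
  exact ⟨v, h⟩

/-- Without a root, the characteristic polynomial would have at 0 both its sign near +∞ and its sign
near -∞, which differ in odd degree. -/
theorem exists_eigenvalue_of_odd_finrank {E : Type*} [AddCommGroup E] [Module ℝ E]
    [FiniteDimensional ℝ E] (h : Odd (Module.finrank ℝ E)) (f : Module.End ℝ E) :
    ∃ a, f.HasEigenvalue a := by
  suffices ∃ a, f.charpoly.IsRoot a by
    obtain ⟨a, ha⟩ := this
    exact ⟨a, (Module.End.hasEigenvalue_iff_isRoot_charpoly f a).mpr ha⟩
  by_contra! hr
  have hlc : 0 ≤ f.charpoly.leadingCoeff := by simp [f.charpoly_monic.leadingCoeff]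
  have h1 := Polynomial.zero_lt_eval_of_roots_lt_of_leadingCoeff_nonneg (x := 0)
    (fun y hy => absurd hy (hr y)) hlc
  have h2 := Polynomial.zero_lt_negOnePow_mul_eval_of_lt_roots_of_leadingCoeff_nonneg (x := 0)
    (fun y hy => absurd hy (hr y)) hlc
  rw [LinearMap.charpoly_natDegree, Int.negOnePow_odd _ (by exact_mod_cast h)] at h2
  push_cast at h2
  linarith

theorem exists_joint_eigenvector_of_odd_finrank {E ι : Type*} [AddCommGroup E] [Module ℝ E]
    [FiniteDimensional ℝ E] (h : Odd (Module.finrank ℝ E))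
    (T : ι → Module.End ℝ E) (hT : ∀ i j, Commute (T i) (T j)) :
    ∃ v : E, v ≠ 0 ∧ ∃ χ : ι → ℝ, ∀ i, T i v = χ i • v := by
  obtain ⟨v, -, h⟩ := exists_joint_eigenvector_of_finrank Odd (by simp)
    (fun a b h => by
      by_contra! hc
      simp only [Nat.not_odd_iff_even] at hc
      exact Nat.not_odd_iff_even.mpr (hc.1.add hc.2) h)
    (fun p hp f => exists_eigenvalue_of_odd_finrank hp f) T hT ⊤
    (by simpa using h) (by simp)
  exact ⟨v, h⟩

/-- A joint eigenvector v of the complexified matrices gives the intertwiner z ↦ Re(z v). It is not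
claimed injective: a real weight may give a line. -/
theorem exists_complex_weight {W ι : Type*} [AddCommGroup W] [Module ℝ W]
    [FiniteDimensional ℝ W] [Nontrivial W]
    (T : ι → Module.End ℝ W) (hT : ∀ i j, Commute (T i) (T j)) :
    ∃ (j : ℂ →ₗ[ℝ] W) (χ : ι → ℂ), j ≠ 0 ∧ ∀ i z, T i (j z) = j (χ i * z) := by
  set b := Module.finBasis ℝ W
  set M := fun i => LinearMap.toMatrixAlgEquiv b (T i) with hM
  set φ : Matrix (Fin (Module.finrank ℝ W)) (Fin (Module.finrank ℝ W)) ℝ →+*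
      Matrix (Fin (Module.finrank ℝ W)) (Fin (Module.finrank ℝ W)) ℂ := Complex.ofRealHom.mapMatrix
  have hMc : ∀ i j, Commute (M i) (M j) := fun i j => (hT i j).map (LinearMap.toMatrixAlgEquiv b)
  have : Nonempty (Fin (Module.finrank ℝ W)) := b.index_nonempty
  obtain ⟨v, hv0, χ, hv⟩ := exists_joint_eigenvector_complex
    (fun i => (Matrix.toLinAlgEquiv' (φ (M i)) :
      Module.End ℂ (Fin (Module.finrank ℝ W) → ℂ)))
    (fun i j => ((hMc i j).map φ).map
      (Matrix.toLinAlgEquiv' (R := ℂ) (n := Fin (Module.finrank ℝ W))))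
  let j0 : ℂ →ₗ[ℝ] (Fin (Module.finrank ℝ W) → ℝ) :=
    LinearMap.pi fun k => Complex.reLm ∘ₗ (LinearMap.mulRight ℝ (v k))
  have hj0 : ∀ z k, j0 z k = (z * v k).re := fun z k => rfl
  refine ⟨b.equivFun.symm.toLinearMap ∘ₗ j0, χ, ?_, ?_⟩
  · intro h
    apply hv0
    have hz : ∀ z, j0 z = 0 := fun z => by
      exact b.equivFun.symm.injective ((LinearMap.congr_fun h z).trans (map_zero _).symm)
    funext k
    have h1 := congrFun (hz 1) k
    have h2 := congrFun (hz Complex.I) k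
    rw [hj0] at h1 h2
    apply Complex.ext
    · simpa using h1
    · simpa using h2
  · intro i z
    have key : (M i).mulVec (j0 z) = j0 (χ i * z) := by
      funext k
      have h1 := congrArg (fun u => (z * u).re) (congrFun (hv i) k)
      simp only [Matrix.toLinAlgEquiv'_apply, Pi.smul_apply, smul_eq_mul] at h1
      rw [hj0, show χ i * z * v k = z * (χ i * v k) by ring, ← h1]
      simp only [Matrix.mulVec, dotProduct, hj0, Finset.mul_sum, Complex.re_sum]
      refine Finset.sum_congr rfl fun l _ => ?_
      simp [φ]
      ring
    rw [LinearMap.comp_apply, LinearMap.comp_apply, ← key]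
    apply b.equivFun.injective
    simp only [LinearEquiv.coe_coe, LinearEquiv.apply_symm_apply]
    have := LinearMap.toMatrix_mulVec_repr b b (T i) (b.equivFun.symm (j0 z))
    rw [Module.Basis.equivFun_apply, ← this]
    congr 1
    have := b.equivFun.apply_symm_apply (j0 z)
    rw [Module.Basis.equivFun_apply] at this
    exact this

/-- On `p` the map `g` is invertible, and a singular `f + s g` makes -s an eigenvalue of g⁻¹f. -/
theorem finite_setOf_pencil_singular {K W : Type*} [Field K] [AddCommGroup W] [Module K W]
    [FiniteDimensional K W] (f g : Module.End K W) (p : Submodule K W)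
    (hf : ∀ w ∈ p, f w ∈ p) (hg : ∀ w ∈ p, g w ∈ p) (hinj : ∀ w ∈ p, g w = 0 → w = 0) :
    {s : K | ∃ w ∈ p, w ≠ 0 ∧ f w + s • g w = 0}.Finite := by
  set g' : Module.End K p := g.restrict hg
  set f' : Module.End K p := f.restrict hf
  have hg' : Function.Injective g' := by
    rw [injective_iff_map_eq_zero]
    exact fun w hw => Subtype.ext (hinj w w.2 (congrArg Subtype.val hw))
  set e := LinearEquiv.ofInjectiveEndo g' hg'
  set h : Module.End K p := e.symm.toLinearMap ∘ₗ f'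
  refine (h.finite_hasEigenvalue.image Neg.neg).subset ?_
  rintro s ⟨w, hw, hw0, hs⟩
  refine ⟨-s, ?_, neg_neg s⟩
  refine Module.End.hasEigenvalue_of_hasEigenvector (x := ⟨w, hw⟩) ⟨?_, ?_⟩
  · rw [Module.End.mem_eigenspace_iff]
    change e.symm (f' ⟨w, hw⟩) = _
    rw [LinearEquiv.symm_apply_eq]
    apply Subtype.ext
    change f w = g (-s • w)
    rw [map_smul, neg_smul]
    exact eq_neg_of_add_eq_zero_left hs
  · exact fun h0 => hw0 (congrArg Subtype.val h0)

/-- A commuting linear family of endomorphisms without common zero vectors contains an injective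
endomorphism. -/
theorem exists_injective_of_commute {L W : Type*} [AddCommGroup L] [Module ℝ L]
    [AddCommGroup W] [Module ℝ W] [FiniteDimensional ℝ W] (T : L →ₗ[ℝ] Module.End ℝ W)
    (hT : ∀ x y, Commute (T x) (T y)) (h0 : ∀ w, (∀ x, T x w = 0) → w = 0) :
    ∃ x, Function.Injective (T x) := by
  suffices H : ∀ p : Submodule ℝ W, (∀ x, ∀ w ∈ p, T x w ∈ p) →
      ∃ x, ∀ w ∈ p, T x w = 0 → w = 0 by
    obtain ⟨x, hx⟩ := H ⊤ (by simp)
    exact ⟨x, (injective_iff_map_eq_zero _).mpr fun w hw => hx w trivial hw⟩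
  intro p hinv
  induction hd : Module.finrank ℝ p using Nat.strong_induction_on generalizing p with
  | _ d ih =>
  subst hd
  rcases subsingleton_or_nontrivial p with hp | hp
  · exact ⟨0, fun w hw _ => congrArg Subtype.val (Subsingleton.elim (⟨w, hw⟩ : p) 0)⟩
  set S : L → Module.End ℝ p := fun x => (T x).restrict (hinv x) with hS
  have hSc : ∀ x y, Commute (S x) (S y) := fun x y =>
    LinearMap.ext fun w => Subtype.ext (LinearMap.congr_fun (hT x y).eq (w : W))
  -- A weight that vanished identically would give a common zero vector, so some `S x` is not
  -- nilpotent. In its Fitting decomposition `S x` is injective on the range part, and the kernel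
  -- part is smaller, hence covered by induction.
  obtain ⟨j, χ, hj0, hj⟩ := exists_complex_weight S hSc
  obtain ⟨z, hz⟩ : ∃ z, j z ≠ 0 := by
    by_contra! h
    exact hj0 (LinearMap.ext h)
  obtain ⟨x, hx⟩ : ∃ x, χ x ≠ 0 := by
    by_contra! h
    refine hz (Subtype.ext (h0 _ fun x => ?_))
    have := congrArg Subtype.val (hj x z)
    simpa [h x, hS] using this
  have hpow : ∀ N : ℕ, ∀ z, (S x ^ N) (j z) = j (χ x ^ N * z) := by
    intro N
    induction N with
    | zero => simp
    | succ N ihN =>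
      intro z
      rw [pow_succ', Module.End.mul_apply, ihN, hj, pow_succ', mul_assoc]
  obtain ⟨N, hN, hN1⟩ := ((S x).eventually_isCompl_ker_pow_range_pow.and
    (Filter.eventually_ge_atTop 1)).exists
  set f := S x ^ N with hfdef
  have hfc : ∀ y, ∀ w, f (S y w) = S y (f w) := fun y w =>
    LinearMap.congr_fun ((hSc x y).pow_left N).eq w
  have hlt : Module.finrank ℝ (LinearMap.ker f) < Module.finrank ℝ p := by
    apply Submodule.finrank_lt
    intro htop
    have : j ((χ x ^ N)⁻¹ * z) ∈ LinearMap.ker f := htop ▸ Submodule.mem_top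
    rw [LinearMap.mem_ker, hpow, mul_inv_cancel_left₀ (pow_ne_zero _ hx)] at this
    exact hz this
  obtain ⟨y, hy⟩ := ih _ hlt ((LinearMap.ker f).map p.subtype) (by
      rintro y _ ⟨w, hw, rfl⟩
      refine ⟨S y w, ?_, rfl⟩
      have hw : f w = 0 := hw
      change f (S y w) = 0
      rw [hfc, hw, map_zero]) (Submodule.finrank_map_subtype_eq p _)
  have hy' : ∀ w ∈ LinearMap.ker f, S y w = 0 → w = 0 := fun w hw h =>
    Subtype.ext (hy w ⟨w, hw, rfl⟩ (congrArg Subtype.val h))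
  have hkerinv : ∀ y, ∀ w ∈ LinearMap.ker f, S y w ∈ LinearMap.ker f := fun y w hw => by
    rw [LinearMap.mem_ker] at hw ⊢
    rw [hfc, hw, map_zero]
  have hraninv : ∀ y, ∀ w ∈ LinearMap.range f, S y w ∈ LinearMap.range f := by
    rintro y _ ⟨w, rfl⟩
    exact ⟨S y w, hfc y w⟩
  have hxinj : ∀ w ∈ LinearMap.range f, S x w = 0 → w = 0 := by
    intro w hw h
    have hk : w ∈ LinearMap.ker f := by
      rw [LinearMap.mem_ker, hfdef, ← Nat.sub_add_cancel hN1, pow_succ, Module.End.mul_apply, h,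
        map_zero]
    exact (Submodule.disjoint_def.mp hN.disjoint) w hk hw
  -- If y is injective on the kernel part, then y + t x is injective on both parts for all but
  -- finitely many t. On the kernel part y + t x = t (x + t⁻¹ y), so there the inverses of the bad
  -- parameters are excluded, together with t = 0.
  have fin0 := finite_setOf_pencil_singular (S x) (S y) _ (hkerinv x) (hkerinv y) hy'
  have fin1 := finite_setOf_pencil_singular (S y) (S x) _ (hraninv y) (hraninv x) hxinj
  obtain ⟨t, ht⟩ := ((fin1.union ((fin0.image Inv.inv).union
    (Set.finite_singleton (0 : ℝ)))).infinite_compl).nonempty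
  simp only [Set.mem_compl_iff, Set.mem_union, not_or, Set.mem_singleton_iff] at ht
  obtain ⟨ht1, ht0, htne⟩ := ht
  refine ⟨y + t • x, fun w hw hw0 => ?_⟩
  have hSw : S y ⟨w, hw⟩ + t • S x ⟨w, hw⟩ = 0 := by
    apply Subtype.ext
    simpa [hS] using hw0
  obtain ⟨w0, hw0k, w1, hw1, hsum⟩ := Submodule.mem_sup.mp
    (hN.sup_eq_top ▸ Submodule.mem_top : (⟨w, hw⟩ : p) ∈ LinearMap.ker f ⊔ LinearMap.range f)
  rw [← hsum] at hSw
  have hm0 : S y w0 + t • S x w0 ∈ LinearMap.ker f :=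
    Submodule.add_mem _ (hkerinv _ _ hw0k) (Submodule.smul_mem _ _ (hkerinv _ _ hw0k))
  have hm1 : S y w1 + t • S x w1 ∈ LinearMap.range f :=
    Submodule.add_mem _ (hraninv _ _ hw1) (Submodule.smul_mem _ _ (hraninv _ _ hw1))
  have hs : (S y w0 + t • S x w0) + (S y w1 + t • S x w1) = 0 := by
    rw [← hSw, map_add, map_add]
    module
  have hz0 : S y w0 + t • S x w0 = 0 := by
    refine (Submodule.disjoint_def.mp hN.disjoint) _ hm0 ?_
    rw [eq_neg_of_add_eq_zero_left hs]
    exact Submodule.neg_mem _ hm1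
  have hz1 : S y w1 + t • S x w1 = 0 := by simpa [hz0] using hs
  have e1 : w1 = 0 := by
    by_contra hne
    exact ht1 ⟨w1, hw1, hne, hz1⟩
  have e0 : w0 = 0 := by
    by_contra hne
    refine ht0 ⟨t⁻¹, ⟨w0, hw0k, hne, ?_⟩, inv_inv t⟩
    have := congrArg (t⁻¹ • ·) hz0
    simpa [smul_add, smul_smul, inv_mul_cancel₀ htne, add_comm] using this
  rw [e0, e1, add_zero] at hsum
  exact (congrArg Subtype.val hsum).symm

end CommutingFamilies

end MDAlgebra

noncomputable section
namespace MDAlgebra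

/-! ### The stabilizer algebra as the radical of a bilinear form. -/

section CoadjointRank

theorem isUnit_expEnd {V : Type*} [AddCommGroup V] [Module ℝ V] [FiniteDimensional ℝ V]
    (f : Module.End ℝ V) : IsUnit (expEnd f) := by
  rw [expEnd_eq_matrix (Module.finBasis ℝ V)]
  exact (Matrix.isUnit_exp _).map (LinearMap.toMatrixAlgEquiv (Module.finBasis ℝ V)).symm

variable {𝒢 : Type*} [LieRing 𝒢] [LieAlgebra ℝ 𝒢]

theorem coadjointOrbit_nontrivial [FiniteDimensional ℝ 𝒢] {F : Module.Dual ℝ 𝒢} {x y : 𝒢} (h : F ⁅x, y⁆ ≠ 0) :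
    (coadjointOrbit F).Nontrivial := by
  have hne : ¬ ∀ t : ℝ, F ∘ₗ expEnd (t • LieAlgebra.ad ℝ 𝒢 x) = F := by
    rw [comp_expEnd_smul_eq_iff]
    exact fun h0 => h (LinearMap.congr_fun h0 y)
  push Not at hne
  obtain ⟨t, ht⟩ := hne
  obtain ⟨g, hg⟩ := isUnit_expEnd (t • LieAlgebra.ad ℝ 𝒢 x)
  have hmem : g ∈ adjointGroup 𝒢 := Subgroup.subset_closure ⟨t • x, by rw [hg, map_smul]⟩
  refine ⟨F, ⟨1, one_mem _, ?_⟩, F ∘ₗ expEnd (t • LieAlgebra.ad ℝ 𝒢 x),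
    ⟨g⁻¹, inv_mem hmem, ?_⟩, fun h => ht h.symm⟩
  · rw [inv_one]
    rfl
  · rw [inv_inv, hg]

/-- Differentiating the one-parameter group at t = 0 identifies the stabilizer algebra with the
radical of the form F⁅x, y⁆. -/
theorem mem_stabilizerAlgebra_iff [FiniteDimensional ℝ 𝒢] {F : Module.Dual ℝ 𝒢} {x : 𝒢} :
    x ∈ stabilizerAlgebra F ↔ ∀ y, F ⁅x, y⁆ = 0 := by
  have : x ∈ stabilizerAlgebra F ↔ ∀ t : ℝ, F ∘ₗ expEnd (t • -LieAlgebra.ad ℝ 𝒢 x) = F := Iff.rfl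
  rw [this, comp_expEnd_smul_eq_iff]
  constructor
  · intro h y
    simpa using LinearMap.congr_fun h y
  · intro h
    ext y
    simp [h y]

/-- The map `x ↦ F ∘ ad x` from a subspace `L` to the dual of a subspace `D`. -/
def pairingMap (L D : Submodule ℝ 𝒢) (F : Module.Dual ℝ 𝒢) : L →ₗ[ℝ] Module.Dual ℝ D :=
  LinearMap.mk₂ ℝ (fun x d => F ⁅(x : 𝒢), (d : 𝒢)⁆) (by simp) (by simp) (by simp) (by simp)

@[simp] theorem pairingMap_apply (L D : Submodule ℝ 𝒢) (F : Module.Dual ℝ 𝒢) (x : L) (d : D) :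
    pairingMap L D F x d = F ⁅(x : 𝒢), (d : 𝒢)⁆ := rfl

/-- Both summands are isotropic for F⁅x, y⁆, so the left and right kernels of the pairing lie in the
radical; their dimensions are dim L - r and dim D - r, where r is the rank. -/
theorem finrank_le_finrank_stabilizerAlgebra_add [FiniteDimensional ℝ 𝒢] {L D : Submodule ℝ 𝒢} (hLD : IsCompl L D)
    (hL : ∀ x ∈ L, ∀ y ∈ L, ⁅x, y⁆ = 0) (hD : ∀ x ∈ D, ∀ y ∈ D, ⁅x, y⁆ = 0)
    (F : Module.Dual ℝ 𝒢) :
    Module.finrank ℝ 𝒢 ≤ Module.finrank ℝ (stabilizerAlgebra F) +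
      2 * Module.finrank ℝ (LinearMap.range (pairingMap L D F)) := by
  set φ := pairingMap L D F
  set K := (LinearMap.ker φ).map L.subtype with hK
  set C := (LinearMap.range φ).dualCoannihilator.map D.subtype with hC
  have hfK : Module.finrank ℝ K = Module.finrank ℝ (LinearMap.ker φ) :=
    Submodule.finrank_map_subtype_eq _ _
  have hfC : Module.finrank ℝ C = Module.finrank ℝ (LinearMap.range φ).dualCoannihilator :=
    Submodule.finrank_map_subtype_eq _ _
  have h1 := φ.finrank_range_add_finrank_ker
  have h2 := Subspace.finrank_add_finrank_dualCoannihilator_eq (LinearMap.range φ)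
  have h3 := Submodule.finrank_add_eq_of_isCompl hLD
  have hdisj : K ⊓ C = ⊥ := by
    rw [eq_bot_iff, ← hLD.inf_eq_bot]
    exact inf_le_inf (Submodule.map_subtype_le _ _) (Submodule.map_subtype_le _ _)
  have h4 := Submodule.finrank_sup_add_finrank_inf_eq K C
  rw [hdisj, finrank_bot] at h4
  have hdecomp : ∀ y : 𝒢, ∃ a : L, ∃ b : D, (a : 𝒢) + b = y := fun y => by
    obtain ⟨a, ha, b, hb, h⟩ := Submodule.mem_sup.mp
      (hLD.sup_eq_top ▸ Submodule.mem_top : y ∈ L ⊔ D)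
    exact ⟨⟨a, ha⟩, ⟨b, hb⟩, h⟩
  have hle : K ⊔ C ≤ stabilizerAlgebra F := by
    apply sup_le
    · rintro _ ⟨x, hx, rfl⟩
      rw [mem_stabilizerAlgebra_iff]
      intro y
      obtain ⟨a, b, rfl⟩ := hdecomp y
      have h0 := LinearMap.congr_fun (LinearMap.mem_ker.mp hx) b
      rw [pairingMap_apply] at h0
      rw [lie_add, map_add, Submodule.subtype_apply, hL x x.2 a a.2, h0]
      simp
    · rintro _ ⟨x, hx, rfl⟩
      rw [mem_stabilizerAlgebra_iff]
      intro y
      obtain ⟨a, b, rfl⟩ := hdecomp y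
      have h0 := (Submodule.mem_dualCoannihilator x).mp hx _ ⟨a, rfl⟩
      rw [pairingMap_apply] at h0
      rw [lie_add, map_add, Submodule.subtype_apply, hD x x.2 b b.2, ← lie_skew, map_neg, h0]
      simp
  have h5 := Submodule.finrank_mono hle
  omega

end CoadjointRank

/-! ### Dimensions and the splitting of the derived algebra. -/

section Structure

variable {𝒢 : Type*} [LieRing 𝒢] [LieAlgebra ℝ 𝒢]

theorem commute_toEnd_of_abelian_ideal (D : LieIdeal ℝ 𝒢) (hD : ∀ x y : 𝒢, ⁅x, y⁆ ∈ D)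
    (hab : ∀ x ∈ D, ∀ y ∈ D, ⁅x, y⁆ = 0) (x y : 𝒢) :
    Commute (LieModule.toEnd ℝ 𝒢 D x) (LieModule.toEnd ℝ 𝒢 D y) := by
  ext d
  simp only [Module.End.mul_apply, LieModule.toEnd_apply_apply, LieSubmodule.coe_bracket]
  rw [leibniz_lie x y (d : 𝒢), hab _ (hD x y) _ d.2, zero_add]

/-- An element acting injectively on an abelian ideal containing all brackets splits the ideal
off: its centralizer is an abelian complement. -/
theorem isCompl_ker_ad [FiniteDimensional ℝ 𝒢] (D : LieIdeal ℝ 𝒢) (hD : ∀ x y : 𝒢, ⁅x, y⁆ ∈ D)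
    (x₀ : 𝒢) (hx₀ : ∀ d ∈ D, ⁅x₀, d⁆ = 0 → d = 0) :
    IsCompl (LinearMap.ker (LieAlgebra.ad ℝ 𝒢 x₀)) D.toSubmodule ∧
      ∀ x ∈ LinearMap.ker (LieAlgebra.ad ℝ 𝒢 x₀),
        ∀ y ∈ LinearMap.ker (LieAlgebra.ad ℝ 𝒢 x₀), ⁅x, y⁆ = 0 := by
  have hinj : Function.Injective (LieModule.toEnd ℝ 𝒢 D x₀) := by
    rw [injective_iff_map_eq_zero]
    exact fun d hd => Subtype.ext (hx₀ d d.2 (congrArg Subtype.val hd))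
  have hsurj := LinearMap.injective_iff_surjective.mp hinj
  refine ⟨⟨?_, ?_⟩, ?_⟩
  · rw [Submodule.disjoint_def]
    intro x hx hxD
    exact hx₀ x hxD hx
  · rw [codisjoint_iff, eq_top_iff]
    intro x _
    -- Brackets lie in `D`, which `x₀` maps onto itself, so subtracting some `d` moves `x` into the
    -- centralizer of `x₀`.
    obtain ⟨d, hd⟩ := hsurj ⟨⁅x₀, x⁆, hD _ _⟩
    have hd : ⁅x₀, (d : 𝒢)⁆ = ⁅x₀, x⁆ := congrArg Subtype.val hd
    refine Submodule.mem_sup.mpr ⟨x - d, ?_, d, d.2, sub_add_cancel _ _⟩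
    simp [hd]
  · intro x hx y hy
    have hx : ⁅x₀, x⁆ = 0 := hx
    have hy : ⁅x₀, y⁆ = 0 := hy
    exact hx₀ _ (hD x y) (by rw [leibniz_lie, hx, hy]; simp)

/-- The rank bound n ≤ 2 + 2r, applied to well-chosen functionals on `D`, fixes both dimensions; the
equality r = 2 = dim L it then forces for every nonzero functional is the injectivity statement. -/
theorem structure_of_finrank_stabilizerAlgebra [FiniteDimensional ℝ 𝒢] (D : LieIdeal ℝ 𝒢)
    (hD : ∀ x y : 𝒢, ⁅x, y⁆ ∈ D) (hab : ∀ x ∈ D, ∀ y ∈ D, ⁅x, y⁆ = 0)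
    (hrad : ∀ F : Module.Dual ℝ 𝒢, (∃ d ∈ D, F d ≠ 0) →
      Module.finrank ℝ (stabilizerAlgebra F) = 2)
    (hn : 6 ≤ Module.finrank ℝ 𝒢) (hder : 3 ≤ Module.finrank ℝ D) :
    Module.finrank ℝ 𝒢 = 6 ∧ Module.finrank ℝ D = 4 ∧
      ∃ y₁ y₂ : 𝒢, ⁅y₁, y₂⁆ = 0 ∧ (∀ a b : ℝ, a • y₁ + b • y₂ ∈ D → a = 0 ∧ b = 0) ∧
        ∀ a b : ℝ, ¬ (a = 0 ∧ b = 0) → ∀ d ∈ D, ⁅a • y₁ + b • y₂, d⁆ = 0 → d = 0 := by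
  set T : 𝒢 →ₗ[ℝ] Module.End ℝ (Module.Dual ℝ D) :=
    Module.Dual.transpose ∘ₗ (LieModule.toEnd ℝ 𝒢 D : 𝒢 →ₗ[ℝ] Module.End ℝ D) with hTdef
  have hTapp : ∀ x F d, T x F d = F ⁅x, d⁆ := fun x F d => rfl
  have hTc : ∀ x y, Commute (T x) (T y) := by
    intro x y
    ext F d
    have := LinearMap.congr_fun (commute_toEnd_of_abelian_ideal D hD hab y x).eq d
    exact congrArg F this
  have hext : ∀ F : Module.Dual ℝ D, F ≠ 0 → ∃ F' : Module.Dual ℝ 𝒢,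
      (∀ d : D, F' d = F d) ∧ Module.finrank ℝ (stabilizerAlgebra F') = 2 := by
    intro F hF
    obtain ⟨F', hF'⟩ := LinearMap.exists_extend (p := D.toSubmodule) F
    have hF'd : ∀ d : D, F' d = F d := fun d => LinearMap.congr_fun hF' d
    refine ⟨F', hF'd, hrad F' ?_⟩
    by_contra! h
    exact hF (LinearMap.ext fun d => (hF'd d).symm.trans (h d d.2))
  have hzero : ∀ F, (∀ x, T x F = 0) → F = 0 := by
    intro F hF
    by_contra hne
    obtain ⟨F', hF', hrk⟩ := hext F hne
    have hle : D.toSubmodule ≤ stabilizerAlgebra F' := by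
      intro d hd
      rw [mem_stabilizerAlgebra_iff]
      intro y
      have h1 : F' ⁅y, d⁆ = F ⁅y, (⟨d, hd⟩ : D)⁆ := hF' ⁅y, (⟨d, hd⟩ : D)⁆
      rw [← lie_skew, map_neg, h1, ← hTapp, hF]
      simp
    have := Submodule.finrank_mono hle
    have h2 : Module.finrank ℝ D.toSubmodule = Module.finrank ℝ D := rfl
    omega
  obtain ⟨x₀, hx₀⟩ := exists_injective_of_commute T hTc hzero
  have hx₀' : ∀ d ∈ D, ⁅x₀, d⁆ = 0 → d = 0 := by
    have hs : Function.Surjective (LieModule.toEnd ℝ 𝒢 D x₀) :=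
      LinearMap.dualMap_injective_iff.mp hx₀
    have hi := LinearMap.injective_iff_surjective.mpr hs
    intro d hd h
    exact congrArg Subtype.val
      ((injective_iff_map_eq_zero _).mp hi ⟨d, hd⟩ (Subtype.ext h))
  obtain ⟨hLD, hL⟩ := isCompl_ker_ad D hD x₀ hx₀'
  set L := LinearMap.ker (LieAlgebra.ad ℝ 𝒢 x₀)
  have hdim := Submodule.finrank_add_eq_of_isCompl hLD
  have hDs : Module.finrank ℝ D.toSubmodule = Module.finrank ℝ D := rfl
  have hbound : ∀ F : Module.Dual ℝ D, F ≠ 0 →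
      Module.finrank ℝ 𝒢 ≤ 2 + 2 * Module.finrank ℝ (LinearMap.range (T.flip F ∘ₗ L.subtype)) := by
    intro F hF
    obtain ⟨F', hF', hrk⟩ := hext F hF
    have h := finrank_le_finrank_stabilizerAlgebra_add hLD hL hab F'
    have he : pairingMap L D.toSubmodule F' = T.flip F ∘ₗ L.subtype := by
      ext x d
      exact hF' ⁅(x : 𝒢), (d : D)⁆
    rwa [hrk, he] at h
  have : Nontrivial D := Module.finrank_pos_iff (R := ℝ).mp (by omega)
  -- For F in the image of a complex weight, the orbit map has values in a space of dimension at
  -- most 2.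
  have hn6 : Module.finrank ℝ 𝒢 = 6 := by
    obtain ⟨j, χ, hj0, hj⟩ := exists_complex_weight T hTc
    obtain ⟨z, hz⟩ : ∃ z, j z ≠ 0 := by
      by_contra! h
      exact hj0 (LinearMap.ext h)
    have h := hbound (j z) hz
    have hle : LinearMap.range (T.flip (j z) ∘ₗ L.subtype) ≤ LinearMap.range j := by
      rintro _ ⟨x, rfl⟩
      exact ⟨χ x * z, (hj x z).symm⟩
    have h1 := Submodule.finrank_mono hle
    have h2 := j.finrank_range_le
    rw [Complex.finrank_real_complex] at h2
    omega
  have hLk : ∀ F : Module.Dual ℝ D, F ≠ 0 →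
      Module.finrank ℝ (LinearMap.range (T.flip F ∘ₗ L.subtype)) ≤ Module.finrank ℝ L :=
    fun F _ => LinearMap.finrank_range_le _
  obtain ⟨F₀, hF₀⟩ := exists_ne (0 : Module.Dual ℝ D)
  have hk2 := hbound F₀ hF₀
  have hk2' := hLk F₀ hF₀
  have hm3 : Module.finrank ℝ D ≠ 3 := by
    intro h3
    obtain ⟨F, hF, χ, hχ⟩ := exists_joint_eigenvector_of_odd_finrank
      (by rw [Subspace.dual_finrank_eq, h3]; decide) T hTc
    have h := hbound F hF
    have hle : LinearMap.range (T.flip F ∘ₗ L.subtype) ≤ ℝ ∙ F := by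
      rintro _ ⟨x, rfl⟩
      exact Submodule.mem_span_singleton.mpr ⟨χ x, (hχ x).symm⟩
    have h1 := Submodule.finrank_mono hle
    rw [finrank_span_singleton hF] at h1
    omega
  -- Rank at least 2 forces dim L ≥ 2, hence dim D ≤ 4.
  have hm4 : Module.finrank ℝ D = 4 := by omega
  have hLdim : Module.finrank ℝ L = 2 := by omega
  refine ⟨hn6, hm4, ?_⟩
  set b : Module.Basis (Fin 2) ℝ L := Module.finBasisOfFinrankEq ℝ L hLdim
  have hb : LinearIndependent ℝ ![b 0, b 1] := by
    have hb' : (⇑b) = ![b 0, b 1] := by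
      funext i
      fin_cases i <;> rfl
    exact hb' ▸ b.linearIndependent
  have hind : ∀ a c : ℝ, a • ((b 0 : L) : 𝒢) + c • ((b 1 : L) : 𝒢) = 0 → a = 0 ∧ c = 0 := by
    intro a c h
    exact LinearIndependent.pair_iff.mp hb a c (Subtype.ext h)
  have hmemL : ∀ a c : ℝ, a • ((b 0 : L) : 𝒢) + c • ((b 1 : L) : 𝒢) ∈ L := fun a c =>
    L.add_mem (L.smul_mem _ (b 0).2) (L.smul_mem _ (b 1).2)
  refine ⟨(b 0 : L), (b 1 : L), hL _ (b 0).2 _ (b 1).2, fun a c h =>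
    hind a c (Submodule.disjoint_def.mp hLD.disjoint _ (hmemL a c) h), ?_⟩
  intro a c hac d hd h0
  have hTinj : Function.Injective (T (a • ((b 0 : L) : 𝒢) + c • ((b 1 : L) : 𝒢))) := by
    rw [injective_iff_map_eq_zero]
    intro F hF
    by_contra hne
    have h1 := hbound F hne
    have h2 := (T.flip F ∘ₗ L.subtype).finrank_range_add_finrank_ker
    -- The rank is at least 2 = dim L, so no nonzero element of `L` kills a nonzero functional on
    -- `D`.
    have h3 : Module.finrank ℝ (LinearMap.ker (T.flip F ∘ₗ L.subtype)) = 0 := by omega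
    rw [Submodule.finrank_eq_zero] at h3
    have h4 : (⟨_, hmemL a c⟩ : L) ∈ LinearMap.ker (T.flip F ∘ₗ L.subtype) := hF
    rw [h3, Submodule.mem_bot] at h4
    exact hac (hind a c (congrArg Subtype.val h4))
  have hs := LinearMap.dualMap_injective_iff.mp hTinj
  have hi := LinearMap.injective_iff_surjective.mpr hs
  exact congrArg Subtype.val ((injective_iff_map_eq_zero _).mp hi ⟨d, hd⟩ (Subtype.ext h0))

end Structure

end MDAlgebra
end

noncomputable section
namespace MDAlgebra

open Complex ComplexConjugate

/-! ### Normal forms of block triangular pencils on ℂ × ℂ. -/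

section Pencils

/-- Equivalence of the pencils spanned by two pairs of endomorphisms: conjugation and a change of
basis of the pencil. -/
def PencilEquiv {V V' : Type*} [AddCommGroup V] [Module ℝ V] [AddCommGroup V'] [Module ℝ V']
    (A B : Module.End ℝ V) (A' B' : Module.End ℝ V') : Prop :=
  ∃ p q r s : ℝ, p * s - q * r ≠ 0 ∧ ∃ Ψ : V' ≃ₗ[ℝ] V, ∀ w,
    p • A (Ψ w) + q • B (Ψ w) = Ψ (A' w) ∧ r • A (Ψ w) + s • B (Ψ w) = Ψ (B' w)

theorem PencilEquiv.trans {V V' V'' : Type*} [AddCommGroup V] [Module ℝ V] [AddCommGroup V']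
    [Module ℝ V'] [AddCommGroup V''] [Module ℝ V''] {A B : Module.End ℝ V}
    {A' B' : Module.End ℝ V'} {A'' B'' : Module.End ℝ V''}
    (h : PencilEquiv A B A' B') (h' : PencilEquiv A' B' A'' B'') : PencilEquiv A B A'' B'' := by
  obtain ⟨p, q, r, s, hd, Ψ, hΨ⟩ := h
  obtain ⟨p', q', r', s', hd', Ψ', hΨ'⟩ := h'
  refine ⟨p' * p + q' * r, p' * q + q' * s, r' * p + s' * r, r' * q + s' * s, ?_, Ψ'.trans Ψ,
    fun w => ⟨?_, ?_⟩⟩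
  · have : (p' * p + q' * r) * (r' * q + s' * s) - (p' * q + q' * s) * (r' * p + s' * r) =
        (p * s - q * r) * (p' * s' - q' * r') := by ring
    rw [this]
    exact mul_ne_zero hd hd'
  · rw [LinearEquiv.trans_apply, LinearEquiv.trans_apply, ← (hΨ' w).1, map_add, map_smul, map_smul,
      ← (hΨ (Ψ' w)).1, ← (hΨ (Ψ' w)).2]
    module
  · rw [LinearEquiv.trans_apply, LinearEquiv.trans_apply, ← (hΨ' w).2, map_add, map_smul, map_smul,
      ← (hΨ (Ψ' w)).1, ← (hΨ (Ψ' w)).2]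
    module

/-- The block upper triangular real endomorphism `(z, w) ↦ (a z + x w + x' conj w, c w)`
of `ℂ × ℂ`. -/
def blockEnd (a x x' c : ℂ) : Module.End ℝ (ℂ × ℂ) where
  toFun p := (a * p.1 + x * p.2 + x' * conj p.2, c * p.2)
  map_add' p q := by
    ext1 <;> simp <;> ring
  map_smul' t p := by
    ext1 <;> simp <;> ring

@[simp] theorem blockEnd_apply (a x x' c : ℂ) (p : ℂ × ℂ) :
    blockEnd a x x' c p = (a * p.1 + x * p.2 + x' * conj p.2, c * p.2) := rfl

/-- The automorphism `(z, w) ↦ (z + e w + e' conj w, w)` of `ℂ × ℂ`. -/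
def shearEquiv (e e' : ℂ) : (ℂ × ℂ) ≃ₗ[ℝ] (ℂ × ℂ) where
  toFun p := (p.1 + e * p.2 + e' * conj p.2, p.2)
  invFun p := (p.1 - e * p.2 - e' * conj p.2, p.2)
  map_add' p q := by
    ext1 <;> simp
    ring
  map_smul' t p := by
    ext1 <;> simp
    ring
  left_inv p := by
    ext1 <;> simp
    ring
  right_inv p := by
    ext1 <;> simp
    ring

@[simp] theorem shearEquiv_apply (e e' : ℂ) (p : ℂ × ℂ) :
    shearEquiv e e' p = (p.1 + e * p.2 + e' * conj p.2, p.2) := rfl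

/-- The linear and antilinear off-diagonal parts change independently; the antilinear one sees conj
c because conj (c w) = conj c · conj w. -/
theorem pencilEquiv_shear (a x x' c b y y' d e e' : ℂ) :
    PencilEquiv (blockEnd a x x' c) (blockEnd b y y' d)
      (blockEnd a (x + (a - c) * e) (x' + (a - conj c) * e') c)
      (blockEnd b (y + (b - d) * e) (y' + (b - conj d) * e') d) := by
  refine ⟨1, 0, 0, 1, by simp, shearEquiv e e', fun w => ⟨?_, ?_⟩⟩ <;> ext1 <;> simp <;> ring

theorem pencilEquiv_scale (a x x' c b y y' d : ℂ) {k : ℂ} (hk : k ≠ 0) :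
    PencilEquiv (blockEnd a x x' c) (blockEnd b y y' d)
      (blockEnd a (x / k) (x' / k) c) (blockEnd b (y / k) (y' / k) d) := by
  refine ⟨1, 0, 0, 1, by simp, ((LinearEquiv.smulOfNeZero ℂ ℂ k hk).restrictScalars ℝ).prodCongr
    (LinearEquiv.refl ℝ ℂ), fun w => ⟨?_, ?_⟩⟩ <;> ext1 <;> simp
  all_goals field_simp

/-- Conjugating only the first factor exchanges the linear and antilinear off-diagonal parts. -/
theorem pencilEquiv_conj_fst (a x x' b y y' : ℂ) :
    PencilEquiv (blockEnd a x x' 1) (blockEnd b y y' (-I))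
      (blockEnd (conj a) (conj x') (conj x) 1) (blockEnd (conj b) (conj y') (conj y) (-I)) := by
  refine ⟨1, 0, 0, 1, by simp, Complex.conjAe.toLinearEquiv.prodCongr (LinearEquiv.refl ℝ ℂ),
    fun w => ⟨?_, ?_⟩⟩ <;> ext1 <;> simp <;> ring

/-- Conjugating both factors turns -I into I, which negating the second generator undoes. The extra
sign in the first factor keeps a real y fixed while it flips the real part of x. -/
theorem pencilEquiv_conj (a x x' b y y' : ℂ) :
    PencilEquiv (blockEnd a x x' 1) (blockEnd b y y' (-I))
      (blockEnd (conj a) (-conj x) (-conj x') 1)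
      (blockEnd (-conj b) (conj y) (conj y') (-I)) := by
  refine ⟨1, 0, 0, -1, by simp, (Complex.conjAe.toLinearEquiv.trans
    (LinearEquiv.neg ℝ)).prodCongr Complex.conjAe.toLinearEquiv,
    fun w => ⟨?_, ?_⟩⟩ <;> ext1 <;> simp
  all_goals ring

/-- After the two factors are exchanged, the basis of the pencil is changed so that the new second
factor again carries 1 and -I. This replaces ζ by its inverse. -/
theorem pencilEquiv_swap {l ζ : ℝ} (μ : ℝ) (hl : l ≠ 0) (hζ : ζ ≠ 0) :
    PencilEquiv (blockEnd l 0 0 1) (blockEnd (μ - ζ * I) 0 0 (-I))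
      (blockEnd (l⁻¹ : ℝ) 0 0 1)
      (blockEnd ((-μ / (l * ζ) : ℝ) - (ζ⁻¹ : ℝ) * I) 0 0 (-I)) := by
  have hl' : (l : ℂ) ≠ 0 := by exact_mod_cast hl
  have hζ' : (ζ : ℂ) ≠ 0 := by exact_mod_cast hζ
  refine ⟨l⁻¹, 0, -μ / (l * ζ), ζ⁻¹, by simp [hl, hζ], LinearEquiv.prodComm ℝ ℂ ℂ,
    fun w => ⟨?_, ?_⟩⟩ <;> ext1 <;> simp <;> field_simp <;> ring

/-- The pencil spanned by `A, B` is equivalent to one of the pencils of the classification. -/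
def HasNormalForm {V : Type*} [AddCommGroup V] [Module ℝ V] (A B : Module.End ℝ V) : Prop :=
  PencilEquiv A B (blockEnd 1 1 0 1) (blockEnd (-I) 0 0 (-I)) ∨
  (∃ ν θ : ℝ, 0 ≤ ν ∧
    PencilEquiv A B (blockEnd 1 (ν - θ * I) 0 1) (blockEnd (-I) (1 / 2) (1 / 2) (-I))) ∨
  (∃ l μ ζ : ℝ, l ≠ 0 ∧ 0 ≤ μ ∧ 0 < ζ ∧ ζ ≤ 1 ∧ (ζ = 1 → |l| ≤ 1) ∧
    PencilEquiv A B (blockEnd l 0 0 1) (blockEnd (μ - ζ * I) 0 0 (-I))) ∨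
  (∃ l μ η ζ : ℝ, η ≠ 0 ∧ 0 < l * ζ - μ * η ∧ 0 ≤ μ ∧
    PencilEquiv A B (blockEnd (l - η * I) 0 0 1) (blockEnd (μ - ζ * I) 0 0 (-I)))

theorem HasNormalForm.of_pencilEquiv {V V' : Type*} [AddCommGroup V] [Module ℝ V]
    [AddCommGroup V'] [Module ℝ V'] {A B : Module.End ℝ V} {A' B' : Module.End ℝ V'}
    (h : HasNormalForm A' B') (h0 : PencilEquiv A B A' B') : HasNormalForm A B := by
  rcases h with h | ⟨ν, θ, h1, h⟩ | ⟨l, μ, ζ, h1, h2, h3, h4, h5, h⟩ | ⟨l, μ, η, ζ, h1, h2, h3, h⟩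
  · exact Or.inl (h0.trans h)
  · exact Or.inr (Or.inl ⟨ν, θ, h1, h0.trans h⟩)
  · exact Or.inr (Or.inr (Or.inl ⟨l, μ, ζ, h1, h2, h3, h4, h5, h0.trans h⟩))
  · exact Or.inr (Or.inr (Or.inr ⟨l, μ, η, ζ, h1, h2, h3, h0.trans h⟩))

/-- Two symmetries remain: `flip1` reverses the sign of the determinant, and `flip2` reverses that
of Re b while keeping the determinant. With a = l - η I and b = μ - ζ I the determinant is -(l ζ - μ
η), so it is made negative. -/
theorem hasNormalForm_split {a b : ℂ} (h : a.re * b.im - a.im * b.re ≠ 0) :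
    HasNormalForm (blockEnd a 0 0 1) (blockEnd b 0 0 (-I)) := by
  have flip1 : ∀ a b : ℂ, PencilEquiv (blockEnd a 0 0 1) (blockEnd b 0 0 (-I))
      (blockEnd (conj a) 0 0 1) (blockEnd (conj b) 0 0 (-I)) := fun a b => by
    simpa using pencilEquiv_conj_fst a 0 0 b 0 0
  have flip2 : ∀ a b : ℂ, PencilEquiv (blockEnd a 0 0 1) (blockEnd b 0 0 (-I))
      (blockEnd (conj a) 0 0 1) (blockEnd (-conj b) 0 0 (-I)) := fun a b => by
    simpa using pencilEquiv_conj a 0 0 b 0 0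
  have refl : ∀ a b : ℂ, PencilEquiv (blockEnd a 0 0 1) (blockEnd b 0 0 (-I))
      (blockEnd a 0 0 1) (blockEnd b 0 0 (-I)) := fun a b => by
    simpa using (flip1 a b).trans (flip1 _ _)
  obtain ⟨a₁, b₁, h₁, hD₁⟩ : ∃ a₁ b₁, PencilEquiv (blockEnd a 0 0 1) (blockEnd b 0 0 (-I))
      (blockEnd a₁ 0 0 1) (blockEnd b₁ 0 0 (-I)) ∧ a₁.re * b₁.im - a₁.im * b₁.re < 0 := by
    rcases lt_or_gt_of_ne h with h | h
    · exact ⟨a, b, refl a b, h⟩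
    · refine ⟨_, _, flip1 a b, ?_⟩
      simp only [conj_re, conj_im]
      linarith
  obtain ⟨a₂, b₂, h₂, hD₂, hμ⟩ : ∃ a₂ b₂, PencilEquiv (blockEnd a 0 0 1) (blockEnd b 0 0 (-I))
      (blockEnd a₂ 0 0 1) (blockEnd b₂ 0 0 (-I)) ∧ a₂.re * b₂.im - a₂.im * b₂.re < 0 ∧
      0 ≤ b₂.re := by
    rcases le_total 0 b₁.re with hb | hb
    · exact ⟨a₁, b₁, h₁, hD₁, hb⟩
    · refine ⟨_, _, h₁.trans (flip2 a₁ b₁), ?_, ?_⟩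
      · simp only [conj_re, conj_im, neg_re, neg_im]
        linarith
      · simpa using hb
  by_cases hη : a₂.im = 0
  · right; right; left
    have key : ∃ l μ ζ : ℝ, l ≠ 0 ∧ 0 ≤ μ ∧ 0 < ζ ∧
        PencilEquiv (blockEnd a 0 0 1) (blockEnd b 0 0 (-I))
          (blockEnd l 0 0 1) (blockEnd (μ - ζ * I) 0 0 (-I)) := by
      rw [hη] at hD₂
      have ha : ((a₂.re : ℝ) : ℂ) = a₂ := Complex.ext (by simp) (by simp [hη])
      have hre : a₂.re ≠ 0 := by
        intro h
        simp [h] at hD₂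
      have him : b₂.im ≠ 0 := by
        intro h
        simp [h] at hD₂
      rcases lt_or_gt_of_ne him with hb | hb
      · refine ⟨a₂.re, b₂.re, -b₂.im, hre, hμ, by linarith, ?_⟩
        rw [ha, show (b₂.re : ℂ) - ((-b₂.im : ℝ) : ℂ) * I = b₂ from
          Complex.ext (by simp) (by simp)]
        exact h₂
      · refine ⟨a₂.re, b₂.re, b₂.im, hre, hμ, hb, ?_⟩
        have := h₂.trans (flip1 a₂ b₂)
        rw [ha]
        rwa [show conj a₂ = a₂ from Complex.ext (by simp) (by simp [hη]),
          show conj b₂ = b₂.re - b₂.im * I from Complex.ext (by simp) (by simp)] at this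
    obtain ⟨l, μ, ζ, hl, hμ, hζ, he⟩ := key
    by_cases hc : ζ ≤ 1 ∧ (ζ = 1 → |l| ≤ 1)
    · exact ⟨l, μ, ζ, hl, hμ, hζ, hc.1, hc.2, he⟩
    -- The factors are exchanged to invert ζ and l; `flip2` supplies the absolute value.
    refine ⟨l⁻¹, |-μ / (l * ζ)|, ζ⁻¹, inv_ne_zero hl, abs_nonneg _, inv_pos.mpr hζ, ?_, ?_, ?_⟩
    · by_contra! h1
      have : ζ < 1 := by
        by_contra! h2
        exact absurd (inv_le_one_of_one_le₀ h2) (not_le.mpr h1)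
      exact hc ⟨this.le, fun h => absurd h this.ne⟩
    · intro h1
      have hζ1 : ζ = 1 := by simpa using h1
      have : ¬ |l| ≤ 1 := fun h => hc ⟨hζ1.le, fun _ => h⟩
      rw [abs_inv]
      exact inv_le_one_of_one_le₀ (not_le.mp this).le
    · have h3 := he.trans (pencilEquiv_swap μ hl hζ.ne')
      rcases abs_choice (-μ / (l * ζ)) with h | h
      · rwa [h]
      · have h5 := h3.trans (flip2 _ _)
        rw [h]
        rwa [Complex.conj_ofReal, show -conj (((-μ / (l * ζ) : ℝ) : ℂ) - (ζ⁻¹ : ℝ) * I) =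
          ((-(-μ / (l * ζ)) : ℝ) : ℂ) - (ζ⁻¹ : ℝ) * I by
            rw [map_sub, map_mul, Complex.conj_ofReal, Complex.conj_ofReal, conj_I, ofReal_neg]
            ring] at h5
  · right; right; right
    refine ⟨a₂.re, b₂.re, -a₂.im, -b₂.im, neg_ne_zero.mpr hη, by linarith, hμ, ?_⟩
    rw [show (a₂.re : ℂ) - ((-a₂.im : ℝ) : ℂ) * I = a₂ from Complex.ext (by simp) (by simp),
      show (b₂.re : ℂ) - ((-b₂.im : ℝ) : ℂ) * I = b₂ from Complex.ext (by simp) (by simp)]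
    exact h₂

/-- Both factors carry the same action, so linear shears have no effect and only scaling and
conjugation can normalize (x, y). The cases are x = y = 0 (split), y = 0 ≠ x (𝔰_{6,211}) and y ≠ 0
(𝔰_{6,225}). -/
theorem hasNormalForm_isotypic (x y : ℂ) :
    HasNormalForm (blockEnd 1 x 0 1) (blockEnd (-I) y 0 (-I)) := by
  by_cases hy : y = 0
  · by_cases hx : x = 0
    · rw [hx, hy]
      exact hasNormalForm_split (by simp)
    · left
      simpa [hy, hx] using pencilEquiv_scale 1 x 0 1 (-I) y 0 (-I) hx
  · right; left
    obtain ⟨n, hn, h⟩ : ∃ n : ℂ, 0 ≤ n.re ∧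
        PencilEquiv (blockEnd 1 x 0 1) (blockEnd (-I) y 0 (-I))
          (blockEnd 1 n 0 1) (blockEnd (-I) (1 / 2) 0 (-I)) := by
      have h1 := pencilEquiv_scale 1 x 0 1 (-I) y 0 (-I) (mul_ne_zero two_ne_zero hy)
      rw [zero_div, show y / (2 * y) = 1 / 2 by field_simp] at h1
      rcases le_total 0 (x / (2 * y)).re with h | h
      · exact ⟨_, h, h1⟩
      · refine ⟨-conj (x / (2 * y)), by rw [neg_re, conj_re]; linarith, ?_⟩
        have h2 := h1.trans (pencilEquiv_conj 1 (x / (2 * y)) 0 (-I) (1 / 2) 0)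
        have h3 : conj (1 / 2 : ℂ) = 1 / 2 := by
          rw [map_div₀, map_one, Complex.conj_ofNat]
        simpa only [map_one, map_zero, neg_zero, map_neg, conj_I, neg_neg, h3] using h2
    refine ⟨n.re, -n.im, hn, ?_⟩
    -- Since (-I - I) · I/4 = 1/2, this antilinear shear turns w/2 into Re w, the form used in
    -- 𝔰_{6,225}; the first generator is unaffected because 1 - conj 1 = 0.
    have h2 := h.trans (pencilEquiv_shear 1 n 0 1 (-I) (1 / 2) 0 (-I) 0 (I / 4))
    have e1 : (1 / 2 : ℂ) + (-I - -I) * 0 = 1 / 2 := by ring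
    have e2 : (0 : ℂ) + (-I - conj (-I)) * (I / 4) = 1 / 2 := by
      rw [map_neg, conj_I]
      linear_combination (-1 / 2) * I_mul_I
    have e3 : n + (1 - 1) * 0 = n.re - ((-n.im : ℝ) : ℂ) * I :=
      Complex.ext (by simp) (by simp)
    have e4 : (0 : ℂ) + (1 - conj (1 : ℂ)) * (I / 4) = 0 := by simp
    rwa [e1, e2, e3, e4] at h2

/-- The commutation relations make (x, y) proportional to (a - 1, b + I) and (x', y') to (a - 1, b -
I) whenever these are nonzero, and a shear then cancels them. At most one of the two vectors can
vanish. -/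
theorem hasNormalForm_block {a x x' b y y' : ℂ} (h : a.re * b.im - a.im * b.re ≠ 0)
    (hc : (a - 1) * y = (b + I) * x) (hc' : (a - 1) * y' = (b - I) * x') :
    HasNormalForm (blockEnd a x x' 1) (blockEnd b y y' (-I)) := by
  have solve : ∀ {c d u v : ℂ}, ¬ (c = 0 ∧ d = 0) → c * v = d * u →
      ∃ e, u + c * e = 0 ∧ v + d * e = 0 := by
    intro c d u v hcd huv
    by_cases hc0 : c = 0
    · have hd0 : d ≠ 0 := fun h => hcd ⟨hc0, h⟩
      have hu : u = 0 := by simpa [hc0, hd0] using huv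
      exact ⟨-v / d, by simp [hc0, hu], by field_simp; ring⟩
    · refine ⟨-u / c, by field_simp; ring, ?_⟩
      field_simp
      linear_combination huv
  have hI : I + I ≠ 0 := by
    intro h
    simpa using congrArg im h
  by_cases h1 : a - 1 = 0 ∧ b + I = 0
  · have ha : a = 1 := sub_eq_zero.mp h1.1
    have hb : b = -I := eq_neg_of_add_eq_zero_left h1.2
    obtain ⟨e', he1, he2⟩ := solve (c := a - 1) (d := b - I)
      (fun h2 => hI (by linear_combination h1.2 - h2.2)) hc'
    have h3 := pencilEquiv_shear a x x' 1 b y y' (-I) 0 e'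
    rw [map_one, map_neg, conj_I, neg_neg, he1, he2, mul_zero, mul_zero, add_zero, add_zero] at h3
    rw [ha, hb] at h3 ⊢
    exact (hasNormalForm_isotypic x y).of_pencilEquiv h3
  obtain ⟨e, he1, he2⟩ := solve h1 hc
  -- Here only the antilinear part survives; conjugating the first factor makes it linear and turns
  -- b = I into -I.
  by_cases h2 : a - 1 = 0 ∧ b - I = 0
  · have ha : a = 1 := sub_eq_zero.mp h2.1
    have hb : b = I := sub_eq_zero.mp h2.2
    have h3 := (pencilEquiv_shear a x x' 1 b y y' (-I) e 0).trans
      (pencilEquiv_conj_fst _ _ _ _ _ _)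
    rw [sub_neg_eq_add, he1, he2, mul_zero, mul_zero, add_zero, add_zero, map_zero] at h3
    rw [ha, hb] at h3 ⊢
    rw [map_one, conj_I] at h3
    exact (hasNormalForm_isotypic _ _).of_pencilEquiv h3
  · obtain ⟨e', he1', he2'⟩ := solve h2 hc'
    have h3 := pencilEquiv_shear a x x' 1 b y y' (-I) e e'
    rw [sub_neg_eq_add, map_one, map_neg, conj_I, neg_neg, he1, he2, he1', he2'] at h3
    exact (hasNormalForm_split h).of_pencilEquiv h3

end Pencils

end MDAlgebra
end

noncomputable section
namespace MDAlgebra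

open Complex ComplexConjugate

/-! ### Reduction of regular pencils to block form. -/

section RegularPencils

theorem exists_real_combination {a b : ℂ} (h : a.re * b.im - a.im * b.re ≠ 0) (c : ℂ) :
    ∃ p q : ℝ, c = p * a + q * b := by
  obtain ⟨p, hp⟩ : ∃ p : ℝ, p * (a.re * b.im - a.im * b.re) = c.re * b.im - c.im * b.re :=
    ⟨_, div_mul_cancel₀ _ h⟩
  obtain ⟨q, hq⟩ : ∃ q : ℝ, q * (a.re * b.im - a.im * b.re) = a.re * c.im - a.im * c.re :=
    ⟨_, div_mul_cancel₀ _ h⟩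
  refine ⟨p, q, Complex.ext (mul_left_cancel₀ h ?_) (mul_left_cancel₀ h ?_)⟩
  · simp only [add_re, re_ofReal_mul]
    linear_combination -a.re * hp - b.re * hq
  · simp only [add_im, im_ofReal_mul]
    linear_combination -a.im * hp - b.im * hq

theorem exists_real_relation {a b : ℂ} (h : a.re * b.im - a.im * b.re = 0) :
    ∃ p q : ℝ, ¬ (p = 0 ∧ q = 0) ∧ (p * a + q * b : ℂ) = 0 := by
  by_cases h1 : b.re = 0 ∧ a.re = 0
  · by_cases h2 : b.im = 0 ∧ a.im = 0
    · exact ⟨1, 0, by simp, Complex.ext (by simp [h1.2]) (by simp [h2.2])⟩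
    · refine ⟨b.im, -a.im, fun h3 => h2 ⟨h3.1, by simpa using h3.2⟩, ?_⟩
      apply Complex.ext
      · simp [h1.1, h1.2]
      · simp
        ring
  · refine ⟨b.re, -a.re, fun h3 => h1 ⟨h3.1, by simpa using h3.2⟩, ?_⟩
    apply Complex.ext
    · simp
      ring
    · simp
      linarith

/-- A pair of endomorphisms all of whose nontrivial real combinations are injective. -/
def IsRegularPencil {V : Type*} [AddCommGroup V] [Module ℝ V] (A B : Module.End ℝ V) : Prop :=
  ∀ p q : ℝ, ¬ (p = 0 ∧ q = 0) → ∀ v, p • A v + q • B v = 0 → v = 0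

/-- A commuting regular pencil has an invariant plane on which it acts through `ℂ`. -/
theorem IsRegularPencil.exists_complex_plane {V : Type*} [AddCommGroup V] [Module ℝ V]
    [FiniteDimensional ℝ V] [Nontrivial V] {A B : Module.End ℝ V} (hAB : Commute A B)
    (hreg : IsRegularPencil A B) :
    ∃ (j : ℂ →ₗ[ℝ] V) (a b : ℂ), Function.Injective j ∧ (∀ z, A (j z) = j (a * z)) ∧
      (∀ z, B (j z) = j (b * z)) ∧ a.re * b.im - a.im * b.re ≠ 0 := by
  obtain ⟨j, χ, hj0, hj⟩ := exists_complex_weight ![A, B] (fun i k => by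
    fin_cases i <;> fin_cases k <;> first | exact Commute.refl _ | exact hAB | exact hAB.symm)
  have hA : ∀ z, A (j z) = j (χ 0 * z) := hj 0
  have hB : ∀ z, B (j z) = j (χ 1 * z) := hj 1
  have hcomb : ∀ (p q : ℝ) z, p • A (j z) + q • B (j z) = j ((p * χ 0 + q * χ 1) * z) := by
    intro p q z
    rw [hA, hB, ← map_smul, ← map_smul, ← map_add, real_smul, real_smul]
    ring_nf
  have hD : (χ 0).re * (χ 1).im - (χ 0).im * (χ 1).re ≠ 0 := by
    intro h
    obtain ⟨p, q, hpq, h0⟩ := exists_real_relation h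
    refine hj0 (LinearMap.ext fun z => hreg p q hpq _ ?_)
    rw [hcomb, h0, zero_mul, map_zero]
  refine ⟨j, χ 0, χ 1, ?_, hA, hB, hD⟩
  rw [injective_iff_map_eq_zero]
  intro z hz
  by_contra hne
  refine hj0 (LinearMap.ext fun w => ?_)
  -- Real combinations of the weights fill ℂ, so a nonzero z in the kernel of `j` puts all of ℂ
  -- there.
  obtain ⟨p, q, hpq⟩ := exists_real_combination hD (w / z)
  have := hcomb p q z
  rw [← hpq, div_mul_cancel₀ _ hne, hA, hB] at this
  rw [← this, ← hA, ← hB, hz]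
  simp

theorem exists_conj_decomposition (f : ℂ →ₗ[ℝ] ℂ) : ∃ x x' : ℂ, ∀ w, f w = x * w + x' * conj w := by
  refine ⟨(f 1 - I * f I) / 2, (f 1 + I * f I) / 2, fun w => ?_⟩
  have h : f w = w.re * f 1 + w.im * f I := by
    conv_lhs => rw [show w = w.re • (1 : ℂ) + w.im • I by simp [re_add_im]]
    rw [map_add, map_smul, map_smul, real_smul, real_smul]
  have h1 : w = w.re + w.im * I := (re_add_im w).symm
  have h2 : conj w = w.re - w.im * I := Complex.ext (by simp) (by simp)
  rw [h, h2]
  linear_combination (-(f 1 - I * f I) / 2) * h1 + w.im * f I * I_mul_I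

theorem IsRegularPencil.exists_block_form {V : Type*} [AddCommGroup V] [Module ℝ V]
    [FiniteDimensional ℝ V] (hV : Module.finrank ℝ V = 4) {A B : Module.End ℝ V}
    (hAB : Commute A B) (hreg : IsRegularPencil A B) :
    ∃ (Ψ : (ℂ × ℂ) ≃ₗ[ℝ] V) (a x x' c b y y' d : ℂ),
      (∀ w, A (Ψ w) = Ψ (blockEnd a x x' c w)) ∧ (∀ w, B (Ψ w) = Ψ (blockEnd b y y' d w)) ∧
      a.re * b.im - a.im * b.re ≠ 0 ∧ c.re * d.im - c.im * d.re ≠ 0 := by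
  have : Nontrivial V := Module.finrank_pos_iff (R := ℝ).mp (by omega)
  obtain ⟨j, a, b, hjinj, hA, hB, hD⟩ := hreg.exists_complex_plane hAB
  set U := LinearMap.range j with hU
  have hUdim : Module.finrank ℝ U = 2 := by
    rw [hU, LinearMap.finrank_range_of_inj hjinj, finrank_real_complex]
  have hQdim := U.finrank_quotient_add_finrank
  have : Nontrivial (V ⧸ U) := Module.finrank_pos_iff (R := ℝ).mp (by omega)
  have hAU : U ≤ U.comap A := by
    rintro _ ⟨z, rfl⟩
    exact ⟨_, (hA z).symm⟩
  have hBU : U ≤ U.comap B := by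
    rintro _ ⟨z, rfl⟩
    exact ⟨_, (hB z).symm⟩
  have hQAB : Commute (U.mapQ U A hAU) (U.mapQ U B hBU) := by
    ext v
    exact congrArg U.mkQ (LinearMap.congr_fun hAB.eq v)
  -- A nontrivial combination acts on `U` as multiplication by a nonzero number, so a vector sent
  -- into `U` can be corrected by an element of `U` to one sent to 0.
  have hQreg : IsRegularPencil (U.mapQ U A hAU) (U.mapQ U B hBU) := by
    intro p q hpq v hv
    obtain ⟨v, rfl⟩ := U.mkQ_surjective v
    have hv' : U.mkQ (p • A v + q • B v) = 0 := by
      rw [← hv]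
      simp
    rw [Submodule.mkQ_apply, Submodule.Quotient.mk_eq_zero] at hv'
    obtain ⟨z, hz⟩ := hv'
    have hne : (p * a + q * b : ℂ) ≠ 0 := by
      intro h0
      have h1 : j 1 = 0 := by
        apply hreg p q hpq
        rw [hA, hB, ← map_smul, ← map_smul, ← map_add, mul_one, mul_one, real_smul, real_smul, h0,
          map_zero]
      exact one_ne_zero (hjinj (h1.trans (map_zero j).symm))
    have hsub : v - j (z / (p * a + q * b)) = 0 := by
      apply hreg p q hpq
      have e : p • A (j (z / (p * a + q * b))) + q • B (j (z / (p * a + q * b))) = j z := by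
        rw [hA, hB, ← map_smul, ← map_smul, ← map_add, real_smul, real_smul]
        congr 1
        field_simp
      rw [map_sub, map_sub, smul_sub, smul_sub, sub_add_sub_comm, e, hz, sub_self]
    rw [Submodule.mkQ_apply, Submodule.Quotient.mk_eq_zero, sub_eq_zero.mp hsub]
    exact ⟨_, rfl⟩
  obtain ⟨k, c, d, hkinj, hkA, hkB, hkD⟩ := hQreg.exists_complex_plane hQAB
  -- Any linear lift of the quotient plane will do; its failure to be invariant becomes the
  -- off-diagonal part.
  obtain ⟨h, hh⟩ := Module.projective_lifting_property U.mkQ k U.mkQ_surjective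
  have hh' : ∀ w, U.mkQ (h w) = k w := fun w => LinearMap.congr_fun hh w
  have hjU : ∀ z, U.mkQ (j z) = 0 := fun z =>
    (Submodule.Quotient.mk_eq_zero U).mpr ⟨z, rfl⟩
  set Φ : (ℂ × ℂ) →ₗ[ℝ] V := j.coprod h
  have hΦ : ∀ z w, Φ (z, w) = j z + h w := fun z w => LinearMap.coprod_apply _ _ _
  have hQΦ : ∀ p, U.mkQ (Φ p) = k p.2 := fun p => by
    rw [hΦ, map_add, hjU, hh', zero_add]
  have hΦinj : Function.Injective Φ := by
    rw [injective_iff_map_eq_zero]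
    rintro ⟨z, w⟩ h0
    have h1 : k w = 0 := by rw [← hQΦ (z, w), h0, map_zero]
    have hw : w = 0 := hkinj (h1.trans (map_zero k).symm)
    rw [hΦ, hw, map_zero, add_zero] at h0
    rw [hw, hjinj (h0.trans (map_zero j).symm)]
    rfl
  set Ψ : (ℂ × ℂ) ≃ₗ[ℝ] V := LinearEquiv.ofInjectiveOfFinrankEq Φ hΦinj
    (by rw [Module.finrank_prod, finrank_real_complex, hV])
  have hΨ : ∀ p, Ψ p = Φ p := fun p => rfl
  have block : ∀ (C : Module.End ℝ V) (hCU : U ≤ U.comap C) (a c : ℂ),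
      (∀ z, C (j z) = j (a * z)) → (∀ w, U.mapQ U C hCU (k w) = k (c * w)) →
      ∃ x x' : ℂ, ∀ p, C (Ψ p) = Ψ (blockEnd a x x' c p) := by
    intro C hCU a c hCa hCc
    obtain ⟨x, x', hx⟩ := exists_conj_decomposition
      (LinearMap.fst ℝ ℂ ℂ ∘ₗ Ψ.symm.toLinearMap ∘ₗ C ∘ₗ h)
    refine ⟨x, x', fun p => ?_⟩
    have h1 : Ψ (Ψ.symm (C (h p.2))) = C (h p.2) := Ψ.apply_symm_apply _
    have h2 : k (Ψ.symm (C (h p.2))).2 = k (c * p.2) := by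
      rw [← hQΦ, ← hΨ, h1, ← hCc, ← hh']
      rfl
    have h3 : Ψ.symm (C (h p.2)) = (x * p.2 + x' * conj p.2, c * p.2) :=
      Prod.ext (hx p.2) (hkinj h2)
    rw [h3] at h1
    rw [hΨ] at h1
    rw [hΨ, hΨ, ← Prod.mk.eta (p := p), hΦ, map_add, hCa, ← h1, hΦ, blockEnd_apply, hΦ,
      add_assoc (a * _), map_add j (a * _), add_assoc]
  obtain ⟨x, x', hx⟩ := block A hAU a c hA hkA
  obtain ⟨y, y', hy⟩ := block B hBU b d hB hkB
  exact ⟨Ψ, a, x, x', c, b, y, y', d, hx, hy, hD, hkD⟩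

/-- Evaluating the commutator at (0, 1) and (0, I) separates its linear part from its antilinear
part. -/
theorem blockEnd_relations {a x x' b y y' : ℂ}
    (h : ∀ w, blockEnd a x x' 1 (blockEnd b y y' (-I) w) =
      blockEnd b y y' (-I) (blockEnd a x x' 1 w)) :
    (a - 1) * y = (b + I) * x ∧ (a - 1) * y' = (b - I) * x' := by
  have c1 := congrArg Prod.fst (h (0, 1))
  have c2 := congrArg Prod.fst (h (0, I))
  simp only [blockEnd_apply, map_one, map_mul, map_neg, conj_I] at c1 c2
  constructor
  · linear_combination (1 / 2) * c1 - (I / 2) * c2 +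
      (1 / 2) * (a * y - a * y' - b * x + b * x' - I * x - I * x' - y + y') * I_mul_I
  · linear_combination (1 / 2) * c1 + (I / 2) * c2 +
      (1 / 2) * (a * y' - a * y - b * x' + b * x + I * x' + I * x - y' + y) * I_mul_I

theorem IsRegularPencil.hasNormalForm {V : Type*} [AddCommGroup V] [Module ℝ V]
    [FiniteDimensional ℝ V] (hV : Module.finrank ℝ V = 4) {A B : Module.End ℝ V}
    (hAB : Commute A B) (hreg : IsRegularPencil A B) : HasNormalForm A B := by
  obtain ⟨Ψ, a, x, x', c, b, y, y', d, hA, hB, hD, hD'⟩ := hreg.exists_block_form hV hAB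
  -- c and d span ℂ over ℝ, so the pencil has a basis acting on the quotient by 1 and -I. The base
  -- change is invertible since its determinant times that of (c, d) is -1.
  obtain ⟨p, q, hpq⟩ := exists_real_combination hD' 1
  obtain ⟨r, s, hrs⟩ := exists_real_combination hD' (-I)
  have hdet : p * s - q * r ≠ 0 := by
    have e1 := congrArg re hpq
    have e2 := congrArg im hpq
    have e3 := congrArg re hrs
    have e4 := congrArg im hrs
    simp at e1 e2 e3 e4
    intro h0
    have : (p * s - q * r) * (c.re * d.im - c.im * d.re) = -1 := by
      linear_combination (-r * c.im - s * d.im) * e1 + (r * c.re + s * d.re) * e2 - e4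
    rw [h0, zero_mul] at this
    norm_num at this
  have hcombA : ∀ w, p • blockEnd a x x' c w + q • blockEnd b y y' d w =
      blockEnd (p * a + q * b) (p * x + q * y) (p * x' + q * y') 1 w := fun w => by
    rw [hpq]
    ext1 <;> simp <;> ring
  have hcombB : ∀ w, r • blockEnd a x x' c w + s • blockEnd b y y' d w =
      blockEnd (r * a + s * b) (r * x + s * y) (r * x' + s * y') (-I) w := fun w => by
    rw [hrs]
    ext1 <;> simp <;> ring
  have hequiv : PencilEquiv A B
      (blockEnd (p * a + q * b) (p * x + q * y) (p * x' + q * y') 1)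
      (blockEnd (r * a + s * b) (r * x + s * y) (r * x' + s * y') (-I)) := by
    refine ⟨p, q, r, s, hdet, Ψ, fun w => ⟨?_, ?_⟩⟩
    · rw [← hcombA, hA, hB, map_add, map_smul, map_smul]
    · rw [← hcombB, hA, hB, map_add, map_smul, map_smul]
  have hcomm : ∀ w, blockEnd a x x' c (blockEnd b y y' d w) =
      blockEnd b y y' d (blockEnd a x x' c w) := fun w => by
    apply Ψ.injective
    rw [← hA, ← hB, ← hB, ← hA]
    exact LinearMap.congr_fun hAB.eq (Ψ w)
  have hcomm' : ∀ w, blockEnd (p * a + q * b) (p * x + q * y) (p * x' + q * y') 1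
      (blockEnd (r * a + s * b) (r * x + s * y) (r * x' + s * y') (-I) w) =
      blockEnd (r * a + s * b) (r * x + s * y) (r * x' + s * y') (-I)
      (blockEnd (p * a + q * b) (p * x + q * y) (p * x' + q * y') 1 w) := fun w => by
    simp only [← hcombA, ← hcombB, map_add, map_smul, hcomm]
    module
  obtain ⟨c1, c2⟩ := blockEnd_relations hcomm'
  refine (hasNormalForm_block ?_ c1 c2).of_pencilEquiv hequiv
  have e : (p * a + q * b : ℂ).re * (r * a + s * b : ℂ).im -
      (p * a + q * b : ℂ).im * (r * a + s * b : ℂ).re =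
      (p * s - q * r) * (a.re * b.im - a.im * b.re) := by
    simp
    ring
  rw [e]
  exact mul_ne_zero hdet hD

end RegularPencils

end MDAlgebra
end

noncomputable section
namespace MDAlgebra

open Complex ComplexConjugate

/-! ### From pencils back to Lie algebras. -/

section Classification

/-- The coordinates of `ℂ × ℂ` with respect to the real basis `(1, 0), (I, 0), (0, 1), (0, I)`. -/
def complexPairEquiv : (Fin 4 → ℝ) ≃ₗ[ℝ] (ℂ × ℂ) where
  toFun w := (⟨w 0, w 1⟩, ⟨w 2, w 3⟩)
  invFun p := ![p.1.re, p.1.im, p.2.re, p.2.im]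
  map_add' v w := rfl
  map_smul' t w := by
    apply Prod.ext <;> apply Complex.ext <;> simp
  left_inv w := by
    funext i
    fin_cases i <;> rfl
  right_inv p := rfl

theorem complexPairEquiv_apply (w : Fin 4 → ℝ) :
    complexPairEquiv w = (⟨w 0, w 1⟩, ⟨w 2, w 3⟩) := rfl

variable {𝒢 : Type*} [LieRing 𝒢] [LieAlgebra ℝ 𝒢]

/-- Two commuting elements and an abelian ideal on which they act through the given matrices
identify the Lie algebra with a semidirect sum. -/
theorem nonempty_lieEquiv_semidirect [FiniteDimensional ℝ 𝒢] (hdim : Module.finrank ℝ 𝒢 = 6)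
    (D : LieIdeal ℝ 𝒢) (hab : ∀ x ∈ D, ∀ y ∈ D, ⁅x, y⁆ = 0) (P : CommutingPair) (x₁ x₂ : 𝒢)
    (h12 : ⁅x₁, x₂⁆ = 0) (hind : ∀ a b : ℝ, a • x₁ + b • x₂ ∈ D → a = 0 ∧ b = 0)
    (Ψ : (Fin 4 → ℝ) ≃ₗ[ℝ] D) (h1 : ∀ w, ⁅x₁, (Ψ w : 𝒢)⁆ = Ψ (P.A.mulVec w))
    (h2 : ∀ w, ⁅x₂, (Ψ w : 𝒢)⁆ = Ψ (P.B.mulVec w)) :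
    Nonempty (𝒢 ≃ₗ⁅ℝ⁆ SemidirectR2R4 P) := by
  let e : SemidirectR2R4 P ≃ₗ[ℝ] (Fin 2 → ℝ) × (Fin 4 → ℝ) :=
    { SemidirectR2R4.toProd with
      map_add' := fun _ _ => rfl
      map_smul' := fun _ _ => rfl }
  have : FiniteDimensional ℝ (SemidirectR2R4 P) := e.symm.finiteDimensional
  have hfr : Module.finrank ℝ (SemidirectR2R4 P) = Module.finrank ℝ 𝒢 := by
    rw [e.finrank_eq, hdim]
    simp
  let f : SemidirectR2R4 P →ₗ[ℝ] 𝒢 :=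
    { toFun := fun x => (x.u 0 • x₁ + x.u 1 • x₂) + (Ψ x.v : 𝒢)
      map_add' := fun x y => by
        simp only [SemidirectR2R4.add_def, Pi.add_apply, map_add, LieSubmodule.coe_add]
        module
      map_smul' := fun c x => by
        simp only [SemidirectR2R4.smul_def, Pi.smul_apply, map_smul, LieSubmodule.coe_smul,
          smul_eq_mul, RingHom.id_apply]
        module }
  have hf : ∀ x, f x = (x.u 0 • x₁ + x.u 1 • x₂) + (Ψ x.v : 𝒢) := fun _ => rfl
  have hinj : Function.Injective f := by
    rw [injective_iff_map_eq_zero]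
    intro x hx
    rw [hf] at hx
    have hmem : x.u 0 • x₁ + x.u 1 • x₂ ∈ D := by
      rw [eq_neg_of_add_eq_zero_left hx]
      exact neg_mem (Ψ x.v).2
    obtain ⟨h0, h1⟩ := hind _ _ hmem
    have hv : x.v = 0 := by
      rw [h0, h1, zero_smul, zero_smul, zero_add, zero_add] at hx
      apply Ψ.injective
      rw [map_zero]
      exact Subtype.ext hx
    apply SemidirectR2R4.ext
    · funext i
      fin_cases i
      · exact h0
      · exact h1
    · exact hv
  have hact : ∀ (u : Fin 2 → ℝ) w, ⁅u 0 • x₁ + u 1 • x₂, (Ψ w : 𝒢)⁆ =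
      Ψ ((SemidirectR2R4.act P u).mulVec w) := by
    intro u w
    rw [add_lie, smul_lie, smul_lie, h1, h2, SemidirectR2R4.act, Matrix.add_mulVec,
      Matrix.smul_mulVec, Matrix.smul_mulVec, map_add, map_smul, map_smul]
    rfl
  have hxx : ∀ a b c d : ℝ, ⁅a • x₁ + b • x₂, c • x₁ + d • x₂⁆ = 0 := by
    intro a b c d
    have h21 : ⁅x₂, x₁⁆ = 0 := by rw [← lie_skew, h12, neg_zero]
    simp [h12, h21]
  have hlie : ∀ x y, f ⁅x, y⁆ = ⁅f x, f y⁆ := by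
    intro x y
    rw [hf, hf, hf, lie_add, add_lie (x.u 0 • x₁ + x.u 1 • x₂) (Ψ x.v : 𝒢),
      add_lie (x.u 0 • x₁ + x.u 1 • x₂) (Ψ x.v : 𝒢), hxx, hab _ (Ψ x.v).2 _ (Ψ y.v).2, hact,
      ← lie_skew (Ψ x.v : 𝒢), hact, SemidirectR2R4.lie_def, map_sub, LieSubmodule.coe_sub]
    simp only [Pi.zero_apply, zero_smul]
    abel
  let E : SemidirectR2R4 P ≃ₗ⁅ℝ⁆ 𝒢 :=
    { LinearEquiv.ofInjectiveOfFinrankEq f hinj hfr with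
      map_lie' := fun {x y} => hlie x y }
  exact ⟨E.symm⟩

theorem nonempty_lieEquiv_of_pencilEquiv [FiniteDimensional ℝ 𝒢]
    (hdim : Module.finrank ℝ 𝒢 = 6)
    (D : LieIdeal ℝ 𝒢) (hab : ∀ x ∈ D, ∀ y ∈ D, ⁅x, y⁆ = 0) {y₁ y₂ : 𝒢}
    (h12 : ⁅y₁, y₂⁆ = 0) (hind : ∀ a b : ℝ, a • y₁ + b • y₂ ∈ D → a = 0 ∧ b = 0)
    {A B : Module.End ℝ (ℂ × ℂ)} (h : PencilEquiv (LieModule.toEnd ℝ 𝒢 D y₁)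
      (LieModule.toEnd ℝ 𝒢 D y₂) A B) (P : CommutingPair)
    (hA : ∀ w, A (complexPairEquiv w) = complexPairEquiv (P.A.mulVec w))
    (hB : ∀ w, B (complexPairEquiv w) = complexPairEquiv (P.B.mulVec w)) :
    Nonempty (𝒢 ≃ₗ⁅ℝ⁆ SemidirectR2R4 P) := by
  obtain ⟨p, q, r, s, hdet, Ψ, hΨ⟩ := h
  have h21 : ⁅y₂, y₁⁆ = 0 := by rw [← lie_skew, h12, neg_zero]
  refine nonempty_lieEquiv_semidirect hdim D hab P (p • y₁ + q • y₂) (r • y₁ + s • y₂)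
    (by simp [h12, h21]) ?_ (complexPairEquiv.trans Ψ) ?_ ?_
  · intro a b hmem
    have hmem' : (a * p + b * r) • y₁ + (a * q + b * s) • y₂ ∈ D := by
      convert hmem using 1
      module
    obtain ⟨e1, e2⟩ := hind _ _ hmem'
    constructor
    · refine (mul_eq_zero.mp ?_).resolve_right hdet
      linear_combination s * e1 - r * e2
    · refine (mul_eq_zero.mp ?_).resolve_right hdet
      linear_combination p * e2 - q * e1
  · intro w
    have := congrArg (Subtype.val : D → 𝒢) (hΨ (complexPairEquiv w)).1
    rw [hA] at this
    rw [LinearEquiv.trans_apply, LinearEquiv.trans_apply, ← this, add_lie, smul_lie, smul_lie]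
    rfl
  · intro w
    have := congrArg (Subtype.val : D → 𝒢) (hΨ (complexPairEquiv w)).2
    rw [hB] at this
    rw [LinearEquiv.trans_apply, LinearEquiv.trans_apply, ← this, add_lie, smul_lie, smul_lie]
    rfl

end Classification

end MDAlgebra
end

theorem theorem3p1 (𝒢 : Type*) [LieRing 𝒢] [LieAlgebra ℝ 𝒢] [FiniteDimensional ℝ 𝒢] (n : ℕ)
    (hdim : Module.finrank ℝ 𝒢 = n) (hn : 6 ≤ n)
    (hsolv : MDAlgebra.IsStepSolvable 𝒢 1)
    (hMD : MDAlgebra.NontrivialCoadjointOrbitsHaveDim 𝒢 (n - 2))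
    (hder : 3 ≤ Module.finrank ℝ (LieAlgebra.derivedSeries ℝ 𝒢 1)) :
    n = 6 ∧ Module.finrank ℝ (LieAlgebra.derivedSeries ℝ 𝒢 1) = 4 ∧
      (Nonempty (𝒢 ≃ₗ⁅ℝ⁆ MDAlgebra.S211) ∨
        (∃ ν θ : ℝ, 0 ≤ ν ∧ Nonempty (𝒢 ≃ₗ⁅ℝ⁆ MDAlgebra.S225 ν θ)) ∨
        (∃ l μ ζ : ℝ, l ≠ 0 ∧ 0 ≤ μ ∧ 0 < ζ ∧ ζ ≤ 1 ∧ (ζ = 1 → |l| ≤ 1) ∧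
          Nonempty (𝒢 ≃ₗ⁅ℝ⁆ MDAlgebra.S226 l μ ζ)) ∨
        (∃ l μ η ζ : ℝ, η ≠ 0 ∧ 0 < l * ζ - μ * η ∧ 0 ≤ μ ∧
          Nonempty (𝒢 ≃ₗ⁅ℝ⁆ MDAlgebra.S228 l μ η ζ))) := by
  open MDAlgebra in
  subst hdim
  set D := LieAlgebra.derivedSeries ℝ 𝒢 1 with hDdef
  have hD : ∀ x y : 𝒢, ⁅x, y⁆ ∈ D := fun x y =>
    LieSubmodule.lie_mem_lie (LieSubmodule.mem_top x) (LieSubmodule.mem_top y)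
  have hab : ∀ x ∈ D, ∀ y ∈ D, ⁅x, y⁆ = 0 := by
    intro x hx y hy
    have := hsolv.1
    exact congrArg Subtype.val (LieModule.IsTrivial.trivial (⟨x, hx⟩ : D) (⟨y, hy⟩ : D))
  have hrad : ∀ F : Module.Dual ℝ 𝒢, (∃ d ∈ D, F d ≠ 0) →
      Module.finrank ℝ (stabilizerAlgebra F) = 2 := by
    rintro F ⟨d, hd, hFd⟩
    -- `D` is spanned by brackets, so F is nonzero on one of them and its orbit is non-trivial.
    obtain ⟨x, y, hxy⟩ : ∃ x y : 𝒢, F ⁅x, y⁆ ≠ 0 := by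
      by_contra! h
      apply hFd
      have hle : D.toSubmodule ≤ LinearMap.ker F := by
        refine (LieAlgebra.coe_derivedSeries_one_eq (R := ℝ) (L := 𝒢)).le.trans ?_
        rw [Submodule.span_le]
        rintro _ ⟨x, y, rfl⟩
        exact h x y
      exact hle hd
    have h1 := hMD F (coadjointOrbit_nontrivial hxy)
    have h2 := Submodule.finrank_le (stabilizerAlgebra F)
    unfold coadjointOrbitDim at h1
    omega
  obtain ⟨h6, h4, y₁, y₂, h12, hind, hreg⟩ :=
    structure_of_finrank_stabilizerAlgebra D hD hab hrad hn hder
  refine ⟨h6, h4, ?_⟩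
  have hregular : IsRegularPencil (LieModule.toEnd ℝ 𝒢 D y₁) (LieModule.toEnd ℝ 𝒢 D y₂) := by
    intro p q hpq v hv
    refine Subtype.ext (hreg p q hpq v v.2 ?_)
    rw [add_lie, smul_lie, smul_lie]
    exact congrArg Subtype.val hv
  have iso : ∀ {A B : Module.End ℝ (ℂ × ℂ)}, _ → ∀ P : CommutingPair, _ → _ →
    Nonempty (𝒢 ≃ₗ⁅ℝ⁆ SemidirectR2R4 P) := fun {A B} =>
      nonempty_lieEquiv_of_pencilEquiv (A := A) (B := B) h6 D hab h12 hind
  rcases hregular.hasNormalForm h4 (commute_toEnd_of_abelian_ideal D hD hab y₁ y₂) with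
    h | ⟨ν, θ, h1, h⟩ | ⟨l, μ, ζ, h1, h2, h3, h4, h5, h⟩ | ⟨l, μ, η, ζ, h1, h2, h3, h⟩
  · refine Or.inl (iso h _ ?_ ?_) <;> intro w <;> apply Prod.ext <;> apply Complex.ext <;>
      simp [complexPairEquiv_apply, dotProduct, Fin.sum_univ_four]
  · refine Or.inr (Or.inl ⟨ν, θ, h1, iso h _ ?_ ?_⟩) <;> intro w <;> apply Prod.ext <;>
      apply Complex.ext <;>
      simp [complexPairEquiv_apply, dotProduct, Fin.sum_univ_four]
    all_goals ring
  · refine Or.inr (Or.inr (Or.inl ⟨l, μ, ζ, h1, h2, h3, h4, h5, iso h _ ?_ ?_⟩)) <;> intro w <;>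
      apply Prod.ext <;> apply Complex.ext <;>
      simp [complexPairEquiv_apply, dotProduct, Fin.sum_univ_four]
    all_goals ring
  · refine Or.inr (Or.inr (Or.inr ⟨l, μ, η, ζ, h1, h2, h3, iso h _ ?_ ?_⟩)) <;> intro w <;>
      apply Prod.ext <;> apply Complex.ext <;>
      simp [complexPairEquiv_apply, dotProduct, Fin.sum_univ_four]
    all_goals ring
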